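/- Let $\lambda>0$ and $\mu>0$. Consider the following continuous-time Markov decision process for a single service. The state $S(t)\in\{0,1,2,\dots\}$ is the number of outstanding requests and the action is $A(t)\in\{0,1\}$ ($1$ = active, $0$ = passive). In state $s$ under action $a$ the process jumps to $s+1$ at rate $\lambda$ (Poisson arrivals) and to $s-1$ at rate $\mu s a$. A policy $\pi$ chooses an action at time $0$ and at each subsequent jump of the state, possibly at random, on the basis of all past jump times, states and actions and of the current jump time and state; the action is kept until the next jump. For a subsidy $W\ge 0$, the cost of $\pi$ from the initial state $s_0$ is $$\bar C_\pi(W,s_0)=\limsup_{T\to\infty}\frac1T\,\mathbb{E}_{\pi}^{s_0}\left[\int_0^T\left(\frac{S(t)}{\lambda}-W\,(1-A(t))\right)dt\right]\in(-\infty,+\infty].$$ A policy $\pi$ is optimal for $W$ if $\bar C_\pi(W,s_0)\le \bar C_{\pi'}(W,s_0)$ for all policies $\pi'$ and all initial states $s_0$. The threshold policy with threshold $R$ is passive in the states $s\le R$ and active in the states $s>R$. Then for every $W\ge 0$ there is a threshold $R\in\{0,1,2,\dots\}$ such that the threshold policy with threshold $R$ is optimal for $W$. The threshold depends on $W$: there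 is no $R\in\mathbb{Z}$ (thresholds $R\le -1$ meaning always active) for which the threshold policy with threshold $R$ is optimal for every $W\ge0$. -/

import Mathlib

open MeasureTheory ProbabilityTheory Filter
open scoped ENNReal

noncomputable section

/-- The data of one service: Poisson arrival rate `lam` of requests and delivery rate `mu`
of each outstanding request while the service is placed at the edge. -/
structure Service where
  lam : ℝ
  mu : ℝ
  lam_pos : 0 < lam
  mu_pos : 0 < mu

namespace Service

/-- Birth rate in state `s` under action `a` (`true` is active, `false` is passive). -/
def birthRate (σ : Service) (_s : ℕ) (_a : Bool) : ℝ := σ.lam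

/-- Death rate in state `s` under action `a`. -/
def deathRate (σ : Service) (s : ℕ) (a : Bool) : ℝ := if a then σ.mu * s else 0

/-- Total rate of events in state `s` under action `a`. -/
def totalRate (σ : Service) (s : ℕ) (a : Bool) : ℝ := σ.birthRate s a + σ.deathRate s a

theorem deathRate_nonneg (σ : Service) (s : ℕ) (a : Bool) : 0 ≤ σ.deathRate s a := by
  unfold deathRate
  split_ifs
  · exact mul_nonneg σ.mu_pos.le (Nat.cast_nonneg s)
  · exact le_rfl

theorem totalRate_pos (σ : Service) (s : ℕ) (a : Bool) : 0 < σ.totalRate s a :=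
  add_pos_of_pos_of_nonneg σ.lam_pos (σ.deathRate_nonneg s a)

/-- Law of the state entered at the next event: a birth or a death, with probabilities
proportional to their rates. In state `0` the death rate vanishes, so the value of
`0 - 1` is irrelevant. -/
def nextState (σ : Service) (s : ℕ) (a : Bool) : Measure ℕ :=
  ENNReal.ofReal (σ.birthRate s a / σ.totalRate s a) • Measure.dirac (s + 1) +
    ENNReal.ofReal (σ.deathRate s a / σ.totalRate s a) • Measure.dirac (s - 1)

instance (σ : Service) (s : ℕ) (a : Bool) : IsProbabilityMeasure (σ.nextState s a) := by
  have ht := σ.totalRate_pos s a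
  constructor
  simp only [nextState, Measure.add_apply, Measure.smul_apply, measure_univ, smul_eq_mul, mul_one]
  rw [← ENNReal.ofReal_add (div_nonneg (show 0 ≤ σ.birthRate s a from σ.lam_pos.le) ht.le)
    (div_nonneg (σ.deathRate_nonneg s a) ht.le), ← add_div]
  change ENNReal.ofReal (σ.totalRate s a / σ.totalRate s a) = 1
  rw [div_self ht.ne', ENNReal.ofReal_one]

/-- Joint law of (waiting time until the next event, state entered at that event), given the
current state and action: the waiting time is exponential with parameter the total rate and is
independent of the state entered. -/
def jumpKernel (σ : Service) : Kernel (ℕ × Bool) (ℝ × ℕ) :=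
  Kernel.ofFunOfCountable fun x =>
    (expMeasure (σ.totalRate x.1 x.2)).prod (σ.nextState x.1 x.2)

instance (σ : Service) : IsMarkovKernel σ.jumpKernel := by
  constructor
  intro x
  have := isProbabilityMeasure_expMeasure (σ.totalRate_pos x.1 x.2)
  change IsProbabilityMeasure
    ((expMeasure (σ.totalRate x.1 x.2)).prod (σ.nextState x.1 x.2))
  infer_instance

end Service

/-- What is recorded at a decision epoch: `((τ, s), a)`, where `τ` is the time elapsed since the
previous epoch (`0` at the initial epoch), `s` is the state entered and `a` the action chosen. -/
abbrev Stage : Type := (ℝ × ℕ) × Bool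

/-- The record of the epochs `0, …, n`. -/
abbrev History (n : ℕ) : Type := (i : Finset.Iic n) → Stage

/-- The last state-action pair of a history. -/
def History.last {n : ℕ} (h : History n) : ℕ × Bool :=
  ((h ⟨n, Finset.mem_Iic.2 le_rfl⟩).1.2, (h ⟨n, Finset.mem_Iic.2 le_rfl⟩).2)

theorem History.measurable_last {n : ℕ} : Measurable (History.last (n := n)) := by
  unfold History.last
  fun_prop

/-- A policy: at time `0` and at every event (arrival or delivery) it chooses an action, possibly
at random, on the basis of all past event times, states and actions and of the current event time
and state. The action is kept until the next event. -/
structure Policy where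
  init : Kernel ℕ Bool
  act : (n : ℕ) → Kernel (History n × (ℝ × ℕ)) Bool
  isMarkovKernel_init : IsMarkovKernel init
  isMarkovKernel_act : ∀ n, IsMarkovKernel (act n)

attribute [instance] Policy.isMarkovKernel_init Policy.isMarkovKernel_act

/-- The threshold policy with threshold `R`: passive in the states `s ≤ R`, active in the states
`s > R`. -/
def thresholdPolicy (R : ℤ) : Policy where
  init := Kernel.deterministic (fun s : ℕ => decide (R < (s : ℤ))) (measurable_of_countable _)
  act n := Kernel.deterministic (fun x : History n × (ℝ × ℕ) => decide (R < (x.2.2 : ℤ)))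
    ((measurable_of_countable (fun s : ℕ => decide (R < (s : ℤ)))).comp
      (measurable_snd.comp measurable_snd))
  isMarkovKernel_init := inferInstance
  isMarkovKernel_act _ := inferInstance

/-- Law of the initial epoch when the process starts in the state `s₀`. -/
def initialLaw (π : Policy) (s₀ : ℕ) : Measure Stage :=
  (π.init s₀).map fun a => (((0 : ℝ), s₀), a)

instance (π : Policy) (s₀ : ℕ) : IsProbabilityMeasure (initialLaw π s₀) :=
  Measure.isProbabilityMeasure_map (measurable_of_countable _).aemeasurable

namespace Service

/-- Law of the next epoch given the history: first the waiting time and the state, then the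
action chosen by the policy. -/
def stepKernel (σ : Service) (π : Policy) (n : ℕ) : Kernel (History n) Stage :=
  (σ.jumpKernel.comap History.last History.measurable_last).compProd (π.act n)

instance (σ : Service) (π : Policy) (n : ℕ) : IsMarkovKernel (σ.stepKernel π n) := by
  unfold stepKernel
  infer_instance

/-- The law, on sequences of epochs, of the controlled process started in `s₀` under `π`. -/
def pathLaw (σ : Service) (π : Policy) (s₀ : ℕ) : Measure (ℕ → Stage) :=
  Kernel.trajMeasure (X := fun _ => Stage) (initialLaw π s₀) (σ.stepKernel π)

end Service

/-- The time of the `n`-th event (`0` for `n = 0`, almost surely). -/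
def eventTime (ω : ℕ → Stage) (n : ℕ) : ℝ := ∑ i ∈ Finset.range (n + 1), (ω i).1.1

/-- The number of events up to and including time `t`. The set is almost surely nonempty for
every `t`, because infinitely many events cannot occur in finite time. -/
def eventCount (ω : ℕ → Stage) (t : ℝ) : ℕ := sInf {n : ℕ | t < eventTime ω (n + 1)}

/-- The number `S(t)` of outstanding requests at time `t`. -/
def stateAt (ω : ℕ → Stage) (t : ℝ) : ℕ := (ω (eventCount ω t)).1.2

/-- The action `A(t)` in force at time `t`. -/
def actionAt (ω : ℕ → Stage) (t : ℝ) : Bool := (ω (eventCount ω t)).2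

namespace Service

/-- The instantaneous cost `s / λ - W (1 - a)` with subsidy `W` for passivity. -/
def runningCost (σ : Service) (W : ℝ) (s : ℕ) (a : Bool) : ℝ :=
  s / σ.lam - W * (1 - (if a then 1 else 0))

/-- The expected cost `E ∫₀ᵀ (S(t) / λ - W (1 - A(t))) dt`, as the integral of the positive part
minus the integral of the negative part; the latter is finite since the running cost is at
least `-|W|`. -/
def expectedCost (σ : Service) (W : ℝ) (π : Policy) (s₀ : ℕ) (T : ℝ) : EReal :=
  ((∫⁻ ω, (∫⁻ t in Set.Ioc 0 T,
      ENNReal.ofReal (σ.runningCost W (stateAt ω t) (actionAt ω t))) ∂(σ.pathLaw π s₀) : ℝ≥0∞)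
        : EReal) -
  ((∫⁻ ω, (∫⁻ t in Set.Ioc 0 T,
      ENNReal.ofReal (-σ.runningCost W (stateAt ω t) (actionAt ω t))) ∂(σ.pathLaw π s₀) : ℝ≥0∞)
        : EReal)

/-- The long-run expected average cost (possibly `+∞`) of `π` from the initial state `s₀`. -/
def averageCost (σ : Service) (W : ℝ) (π : Policy) (s₀ : ℕ) : EReal :=
  limsup (fun T : ℝ => ((T⁻¹ : ℝ) : EReal) * σ.expectedCost W π s₀ T) atTop

/-- `π` minimizes the long-run average cost among all policies, from every initial state. -/
def IsOptimal (σ : Service) (W : ℝ) (π : Policy) : Prop :=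
  ∀ (s₀ : ℕ) (π' : Policy), σ.averageCost W π s₀ ≤ σ.averageCost W π' s₀

end Service

end

/-! Adding `W` to the cost makes it nonnegative and shifts every gain by `W`. Optimality is then a
verification argument: a function `h` on the states and a constant `G` satisfying a Bellman
inequality bound the expected cost up to `T` by `G * T`, up to a bounded error.

Let X be Poisson with mean ρ = λ/μ and r(s) = P(X > s)/P(X = s) (`tailRatio`). Under the threshold R
≥ 0 the state settles to X conditioned on X ≥ R, so the gain is 1/μ - k with k = (W - R/λ)/(1 +
r(R)) (`thresholdSaving`); the best threshold maximizes k. The increments (1/μ + k r(s))/λ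
(`valueSlope`) solve the active Poisson equation exactly at s ≥ 1. The passive residual at s is k(1
+ r(s)) - (W - s/λ), which is nonnegative at every s once k dominates all the savings; the active
residual at 0 is k(1 + r(0)). This gives `averageCost_thresholdPolicy_le` and
`le_averageCost_of_action`. The second needs a bounded `h`, obtained by truncating the increments.

No threshold serves all subsidies: a positive one loses at W = 0 to the threshold 0, and a
nonpositive one loses to the threshold 1 for large W, because r(1) < r(0). -/

/-! ### Integrals against the exponential law -/

theorem one_sub_exp_neg_nonneg {x : ℝ} (hx : 0 ≤ x) : 0 ≤ 1 - Real.exp (-x) := by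
  simpa using hx

theorem sub_one_sub_exp_neg_div_nonneg {q : ℝ} (hq : 0 < q) (r : ℝ) :
    0 ≤ r - (1 - Real.exp (-(q * r))) / q := by
  rw [sub_nonneg, div_le_iff₀ hq]
  linarith [Real.add_one_le_exp (-(q * r)), mul_comm q r]

theorem expMeasure_Iic {q : ℝ} (hq : 0 < q) {r : ℝ} (hr : 0 ≤ r) :
    expMeasure q (Set.Iic r) = ENNReal.ofReal (1 - Real.exp (-(q * r))) := by
  have h := lintegral_exponentialPDF_eq_antiDeriv hq r
  rw [if_pos hr] at h
  rw [← h, expMeasure, gammaMeasure, withDensity_apply _ measurableSet_Iic]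
  rfl

theorem expMeasure_Ioi {q : ℝ} (hq : 0 < q) {r : ℝ} (hr : 0 ≤ r) :
    expMeasure q (Set.Ioi r) = ENNReal.ofReal (Real.exp (-(q * r))) := by
  have := isProbabilityMeasure_expMeasure hq
  rw [← Set.compl_Iic, prob_compl_eq_one_sub measurableSet_Iic, expMeasure_Iic hq hr,
    ← ENNReal.ofReal_one, ← ENNReal.ofReal_sub _ (by simp; positivity)]
  congr 1
  ring

theorem ae_pos_expMeasure {q : ℝ} (hq : 0 < q) : ∀ᵐ x ∂expMeasure q, 0 < x := by
  have h := expMeasure_Iic hq le_rfl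
  rw [ae_iff]
  simpa [Set.Iic] using h

/-- Layer cake: the tail P(x > t) equals the density at t divided by q, so the integral is the
distribution function at r over q. -/
theorem lintegral_min_expMeasure {q : ℝ} (hq : 0 < q) {r : ℝ} (hr : 0 ≤ r) :
    ∫⁻ x, ENNReal.ofReal (min x r) ∂expMeasure q
      = ENNReal.ofReal ((1 - Real.exp (-(q * r))) / q) := by
  rw [lintegral_eq_lintegral_meas_lt]
  rotate_left
  · filter_upwards [ae_pos_expMeasure hq] with x hx using le_min hx.le hr
  · fun_prop
  have h1 : ∀ t ∈ Set.Ioi (0 : ℝ), expMeasure q {x | t < min x r}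
      = (Set.Iio r).indicator (fun t => ENNReal.ofReal (q⁻¹) * exponentialPDF q t) t := by
    intro t ht
    have ht : 0 < t := ht
    by_cases h : t < r
    · have : {x : ℝ | t < min x r} = Set.Ioi t := by ext; simp [h]
      rw [this, expMeasure_Ioi hq ht.le, Set.indicator_of_mem (by exact h),
        exponentialPDF_of_nonneg ht.le, ← ENNReal.ofReal_mul (by positivity)]
      congr 1
      field_simp
    · have : {x : ℝ | t < min x r} = ∅ := by ext; simp [h]
      rw [this, Set.indicator_of_notMem (by exact h), measure_empty]
  rw [setLIntegral_congr_fun measurableSet_Ioi h1, setLIntegral_indicator measurableSet_Iio,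
    lintegral_const_mul' _ _ ENNReal.ofReal_ne_top]
  have h2 : ∫⁻ y in Set.Iio r ∩ Set.Ioi 0, exponentialPDF q y
      = ∫⁻ y in Set.Iic r, exponentialPDF q y := by
    rw [← lintegral_indicator (by measurability), ← lintegral_indicator measurableSet_Iic]
    apply lintegral_congr_ae
    filter_upwards [Measure.ae_ne volume r, Measure.ae_ne volume (0 : ℝ)] with x hx hx0
    rcases lt_or_gt_of_ne hx0 with h | h
    · have : exponentialPDF q x = 0 := exponentialPDF_of_neg h
      simp [Set.indicator, this]
    · simp [Set.indicator, h, lt_iff_le_and_ne, hx]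
  rw [h2, lintegral_exponentialPDF_eq_antiDeriv hq, if_pos hr,
    ← ENNReal.ofReal_mul (by positivity)]
  congr 1
  field_simp

theorem lintegral_exp_neg_expMeasure {q : ℝ} (hq : 0 < q) :
    ∫⁻ x, ENNReal.ofReal (Real.exp (-x)) ∂expMeasure q = ENNReal.ofReal (q / (q + 1)) := by
  have : expMeasure q = volume.withDensity (exponentialPDF q) := rfl
  have hm : Measurable (exponentialPDF q) := (measurable_exponentialPDFReal q).ennreal_ofReal
  rw [this, lintegral_withDensity_eq_lintegral_mul _ hm (by fun_prop)]
  have h : ∀ x, (exponentialPDF q * fun x => ENNReal.ofReal (Real.exp (-x))) x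
      = ENNReal.ofReal (q / (q + 1)) * exponentialPDF (q + 1) x := by
    intro x
    rcases lt_or_ge x 0 with hx | hx
    · simp [exponentialPDF_of_neg hx]
    · rw [Pi.mul_apply, exponentialPDF_of_nonneg hx, exponentialPDF_of_nonneg hx,
        ← ENNReal.ofReal_mul (by positivity), ← ENNReal.ofReal_mul (by positivity)]
      congr 1
      rw [mul_assoc, ← Real.exp_add]
      field_simp
      ring_nf
  rw [lintegral_congr h, lintegral_const_mul' _ _ ENNReal.ofReal_ne_top,
    lintegral_exponentialPDF_eq_one (by positivity), mul_one]

theorem lintegral_sub_expMeasure {q : ℝ} (hq : 0 < q) {r : ℝ} (hr : 0 ≤ r) :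
    ∫⁻ x, ENNReal.ofReal (r - x) ∂expMeasure q
      = ENNReal.ofReal (r - (1 - Real.exp (-(q * r))) / q) := by
  have := isProbabilityMeasure_expMeasure hq
  have hF : 0 ≤ 1 - Real.exp (-(q * r)) :=
    one_sub_exp_neg_nonneg (by positivity)
  have h : ∫⁻ x, ENNReal.ofReal (r - x) ∂expMeasure q
      + ∫⁻ x, ENNReal.ofReal (min x r) ∂expMeasure q = ENNReal.ofReal r := by
    rw [← lintegral_add_left (by fun_prop)]
    have : ∀ᵐ x ∂expMeasure q,
        ENNReal.ofReal (r - x) + ENNReal.ofReal (min x r) = ENNReal.ofReal r := by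
      filter_upwards [ae_pos_expMeasure hq] with x hx
      rcases le_total x r with h | h
      · rw [min_eq_left h, ← ENNReal.ofReal_add (by linarith) hx.le]
        congr 1
        ring
      · rw [min_eq_right h, ENNReal.ofReal_of_nonpos (by linarith), zero_add]
    rw [lintegral_congr_ae this]
    simp
  rw [ENNReal.ofReal_sub _ (by positivity), ← h, lintegral_min_expMeasure hq hr,
    ENNReal.add_sub_cancel_right ENNReal.ofReal_ne_top]

/-! ### One jump: mean over the next state and the one-step verification inequalities -/

namespace Service

theorem lintegral_nextState (σ : Service) (s : ℕ) (a : Bool) (f : ℕ → ℝ≥0∞) :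
    ∫⁻ s', f s' ∂σ.nextState s a
      = ENNReal.ofReal (σ.birthRate s a / σ.totalRate s a) * f (s + 1)
        + ENNReal.ofReal (σ.deathRate s a / σ.totalRate s a) * f (s - 1) := by
  simp [nextState, lintegral_add_measure, lintegral_smul_measure]

/-- Expected value of `h` at the next state. -/
noncomputable def nextMean (σ : Service) (h : ℕ → ℝ) (s : ℕ) (a : Bool) : ℝ :=
  (σ.birthRate s a * h (s + 1) + σ.deathRate s a * h (s - 1)) / σ.totalRate s a

theorem lintegral_ofReal_nextState (σ : Service) (s : ℕ) (a : Bool) {h : ℕ → ℝ}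
    (hh : ∀ s, 0 ≤ h s) :
    ∫⁻ s', ENNReal.ofReal (h s') ∂σ.nextState s a = ENNReal.ofReal (σ.nextMean h s a) := by
  have h1 := (σ.totalRate_pos s a).le
  have h2 := σ.deathRate_nonneg s a
  have h3 : 0 ≤ σ.birthRate s a := σ.lam_pos.le
  rw [lintegral_nextState, ← ENNReal.ofReal_mul (by positivity), ← ENNReal.ofReal_mul (by positivity),
    ← ENNReal.ofReal_add (mul_nonneg (by positivity) (hh _)) (mul_nonneg (by positivity) (hh _)),
    nextMean]
  congr 1
  ring

theorem nextMean_nonneg (σ : Service) (s : ℕ) (a : Bool) {h : ℕ → ℝ}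
    (hh : ∀ s, 0 ≤ h s) : 0 ≤ σ.nextMean h s a :=
  div_nonneg (add_nonneg (mul_nonneg σ.lam_pos.le (hh _))
    (mul_nonneg (σ.deathRate_nonneg s a) (hh _))) (σ.totalRate_pos s a).le

end Service

/-- The affine potential `G r + h s` as long as the remaining time `r` is nonnegative. -/
noncomputable def potential (G : ℝ) (h : ℕ → ℝ) (r : ℝ) (s : ℕ) : ℝ≥0∞ :=
  ENNReal.ofReal G * ENNReal.ofReal r + (Set.Ici (0 : ℝ)).indicator 1 r * ENNReal.ofReal (h s)

theorem potential_of_nonneg {G : ℝ} (hG : 0 ≤ G) {h : ℕ → ℝ} (hh : ∀ s, 0 ≤ h s) {r : ℝ}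
    (hr : 0 ≤ r) (s : ℕ) : potential G h r s = ENNReal.ofReal (G * r + h s) := by
  rw [potential, ← ENNReal.ofReal_mul hG, Set.indicator_of_mem (by exact hr), Pi.one_apply, one_mul,
    ← ENNReal.ofReal_add (by positivity) (hh s)]

theorem potential_of_neg (G : ℝ) (h : ℕ → ℝ) {r : ℝ} (hr : r < 0) (s : ℕ) :
    potential G h r s = 0 := by
  rw [potential, ENNReal.ofReal_of_nonpos hr.le, Set.indicator_of_notMem (by simpa using hr)]
  simp

theorem measurable_potential (G : ℝ) (h : ℕ → ℝ) :
    Measurable fun p : ℝ × ℕ => potential G h p.1 p.2 := by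
  unfold potential
  have h1 : Measurable (Set.indicator (Set.Ici (0 : ℝ)) (1 : ℝ → ℝ≥0∞)) :=
    measurable_one.indicator measurableSet_Ici
  have h2 : Measurable fun s : ℕ => ENNReal.ofReal (h s) := measurable_of_countable _
  exact (by fun_prop : Measurable fun p : ℝ × ℕ => ENNReal.ofReal G * ENNReal.ofReal p.1).add
    ((h1.comp measurable_fst).mul (h2.comp measurable_snd))

namespace Service

theorem lintegral_potential (σ : Service) {G : ℝ} (hG : 0 ≤ G) {h : ℕ → ℝ} (hh : ∀ s, 0 ≤ h s)
    {r : ℝ} (hr : 0 ≤ r) (s : ℕ) (a : Bool) :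
    ∫⁻ y, potential G h (r - y.1) y.2
        ∂((expMeasure (σ.totalRate s a)).prod (σ.nextState s a))
      = ENNReal.ofReal (G * (r - (1 - Real.exp (-(σ.totalRate s a * r))) / σ.totalRate s a)
          + (1 - Real.exp (-(σ.totalRate s a * r))) * σ.nextMean h s a) := by
  have hq := σ.totalRate_pos s a
  set q := σ.totalRate s a
  have := isProbabilityMeasure_expMeasure hq
  have hF : 0 ≤ 1 - Real.exp (-(q * r)) :=
    one_sub_exp_neg_nonneg (by positivity)
  have hm := sub_one_sub_exp_neg_div_nonneg hq r
  have hmeas : Measurable fun y : ℝ × ℕ => potential G h (r - y.1) y.2 :=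
    (measurable_potential G h).comp (by fun_prop : Measurable fun y : ℝ × ℕ => (r - y.1, y.2))
  rw [lintegral_prod _ hmeas.aemeasurable]
  have h1 : ∀ x : ℝ, ∫⁻ s', potential G h (r - x) s' ∂σ.nextState s a
      = ENNReal.ofReal G * ENNReal.ofReal (r - x)
        + (Set.Iic r).indicator 1 x * ENNReal.ofReal (σ.nextMean h s a) := by
    intro x
    have h2 : (Set.Ici (0 : ℝ)).indicator (1 : ℝ → ℝ≥0∞) (r - x) = (Set.Iic r).indicator 1 x := by
      simp [Set.indicator]
    simp_rw [potential, h2]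
    rw [lintegral_add_left measurable_const, lintegral_const, measure_univ, mul_one,
      lintegral_const_mul _ (measurable_of_countable _), lintegral_ofReal_nextState _ _ _ hh]
  simp_rw [h1]
  rw [lintegral_add_left (by fun_prop), lintegral_const_mul _ (by fun_prop),
    lintegral_mul_const _ (measurable_one.indicator measurableSet_Iic),
    lintegral_indicator_one measurableSet_Iic, expMeasure_Iic hq hr, lintegral_sub_expMeasure hq hr,
    ← ENNReal.ofReal_mul hG, ← ENNReal.ofReal_mul hF,
    ← ENNReal.ofReal_add (by positivity) (mul_nonneg hF (σ.nextMean_nonneg s a hh))]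

/-- One step of the upper verification inequality. -/
theorem potential_step_le (σ : Service) {c G : ℝ} (hc : 0 ≤ c) (hG : 0 ≤ G) {h : ℕ → ℝ}
    (hh : ∀ s, 0 ≤ h s) (s : ℕ) (a : Bool)
    (hle : c - G + σ.totalRate s a * (σ.nextMean h s a - h s) ≤ 0) (r : ℝ) :
    ∫⁻ y, ENNReal.ofReal c * ENNReal.ofReal (min y.1 r) + potential G h (r - y.1) y.2
        ∂((expMeasure (σ.totalRate s a)).prod (σ.nextState s a)) ≤ potential G h r s := by
  have hq := σ.totalRate_pos s a
  have := isProbabilityMeasure_expMeasure hq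
  rcases lt_or_ge r 0 with hr | hr
  · have h0 : ∀ᵐ y ∂((expMeasure (σ.totalRate s a)).prod (σ.nextState s a)), (0 : ℝ) < y.1 :=
      Measure.quasiMeasurePreserving_fst.ae (ae_pos_expMeasure hq)
    rw [lintegral_congr_ae (g := fun _ => 0)]
    · simp
    · filter_upwards [h0] with y hy
      rw [potential_of_neg _ _ (by linarith), min_eq_right (by linarith),
        ENNReal.ofReal_of_nonpos hr.le]
      simp
  · rw [lintegral_add_left (by fun_prop), lintegral_potential σ hG hh hr,
      lintegral_const_mul _ (by fun_prop), lintegral_prod _ (by fun_prop)]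
    simp only [lintegral_const, measure_univ, mul_one]
    rw [lintegral_min_expMeasure hq hr, potential_of_nonneg hG hh hr, ← ENNReal.ofReal_mul hc]
    set q := σ.totalRate s a
    have hF : 0 ≤ 1 - Real.exp (-(q * r)) :=
    one_sub_exp_neg_nonneg (by positivity)
    have hm := sub_one_sub_exp_neg_div_nonneg hq r
    rw [← ENNReal.ofReal_add (by positivity)
      (add_nonneg (by positivity) (mul_nonneg hF (σ.nextMean_nonneg s a hh)))]
    apply ENNReal.ofReal_le_ofReal
    have hFq : 0 ≤ (1 - Real.exp (-(q * r))) / q := by positivity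
    have h1 := mul_nonpos_of_nonneg_of_nonpos hFq hle
    -- The two sides differ by `h3` minus e^{-qr} h(s): if no jump occurs before the horizon, the
    -- potential h(s) is simply lost. For an upper bound this loss may be dropped.
    have h2 := mul_nonneg (Real.exp_pos (-(q * r))).le (hh s)
    have h3 : (1 - Real.exp (-(q * r))) / q * (c - G + q * (σ.nextMean h s a - h s))
      = (1 - Real.exp (-(q * r))) / q * (c - G) + (1 - Real.exp (-(q * r))) * (σ.nextMean h s a - h s) := by
      field_simp
    nlinarith

/-- One step of the lower verification inequality. -/
theorem le_potential_step (σ : Service) {c G H : ℝ} (hc : 0 ≤ c) (hG : 0 ≤ G) {h : ℕ → ℝ}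
    (hh : ∀ s, 0 ≤ h s) (hH : ∀ s, h s ≤ H) (s : ℕ) (a : Bool)
    (hle : 0 ≤ c - G + σ.totalRate s a * (σ.nextMean h s a - h s)) (r : ℝ) :
    potential G h r s ≤
      ∫⁻ y, ENNReal.ofReal c * ENNReal.ofReal (min y.1 r) + potential G h (r - y.1) y.2
        + ENNReal.ofReal H * (Set.Ici (0 : ℝ)).indicator 1 r * (Set.Ioi r).indicator 1 y.1
        ∂((expMeasure (σ.totalRate s a)).prod (σ.nextState s a)) := by
  have hq := σ.totalRate_pos s a
  have := isProbabilityMeasure_expMeasure hq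
  rcases lt_or_ge r 0 with hr | hr
  · rw [potential_of_neg _ _ hr]
    exact zero_le
  · have hI : Measurable ((Set.Ioi r).indicator (1 : ℝ → ℝ≥0∞)) :=
      measurable_one.indicator measurableSet_Ioi
    rw [lintegral_add_right _ (by fun_prop), lintegral_add_left (by fun_prop),
      lintegral_potential σ hG hh hr,
      lintegral_const_mul _ (by fun_prop), lintegral_prod _ (by fun_prop),
      lintegral_const_mul _ (by fun_prop),
      lintegral_prod (fun y : ℝ × ℕ => (Set.Ioi r).indicator (1 : ℝ → ℝ≥0∞) y.1) (by fun_prop)]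
    simp only [lintegral_const, measure_univ, mul_one]
    rw [lintegral_min_expMeasure hq hr, potential_of_nonneg hG hh hr, ← ENNReal.ofReal_mul hc,
      lintegral_indicator_one measurableSet_Ioi, expMeasure_Ioi hq hr,
      Set.indicator_of_mem (by exact hr), Pi.one_apply, mul_one]
    set q := σ.totalRate s a
    have hF : 0 ≤ 1 - Real.exp (-(q * r)) :=
    one_sub_exp_neg_nonneg (by positivity)
    have hm := sub_one_sub_exp_neg_div_nonneg hq r
    have hH0 : 0 ≤ H := (hh s).trans (hH s)
    rw [← ENNReal.ofReal_mul hH0, ← ENNReal.ofReal_add (by positivity)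
      (add_nonneg (by positivity) (mul_nonneg hF (σ.nextMean_nonneg s a hh))),
      ← ENNReal.ofReal_add (add_nonneg (by positivity)
      (add_nonneg (by positivity) (mul_nonneg hF (σ.nextMean_nonneg s a hh)))) (by positivity)]
    apply ENNReal.ofReal_le_ofReal
    have hFq : 0 ≤ (1 - Real.exp (-(q * r))) / q := by positivity
    have h1 := mul_nonneg hFq hle
    have h2 := mul_le_mul_of_nonneg_left (hH s) (Real.exp_pos (-(q * r))).le
    have h3 : (1 - Real.exp (-(q * r))) / q * (c - G + q * (σ.nextMean h s a - h s))
      = (1 - Real.exp (-(q * r))) / q * (c - G) + (1 - Real.exp (-(q * r))) * (σ.nextMean h s a - h s) := by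
      field_simp
    nlinarith

end Service

/-! ### Markov property of the epochs and almost sure properties of paths -/

theorem measurable_eventTime (n : ℕ) : Measurable fun ω : ℕ → Stage => eventTime ω n := by
  unfold eventTime
  fun_prop

theorem eventTime_succ (ω : ℕ → Stage) (n : ℕ) :
    eventTime ω (n + 1) = eventTime ω n + (ω (n + 1)).1.1 := by
  simp [eventTime, Finset.sum_range_succ]

/-- Event time, state and action at the `n`-th epoch. -/
noncomputable def epochData (n : ℕ) (ω : ℕ → Stage) : ℝ × ℕ × Bool :=
  (eventTime ω n, (ω n).1.2, (ω n).2)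

theorem measurable_epochData (n : ℕ) : Measurable (epochData n) := by
  have := measurable_eventTime n
  unfold epochData
  fun_prop

/-- Event time, state and action at the last epoch of a history. -/
noncomputable def History.epochData {n : ℕ} (h : History n) : ℝ × ℕ × Bool :=
  (∑ i, (h i).1.1, h.last)

theorem History.measurable_epochData {n : ℕ} : Measurable (History.epochData (n := n)) := by
  have := History.measurable_last (n := n)
  unfold History.epochData
  fun_prop

theorem epochData_frestrictLe (n : ℕ) (ω : ℕ → Stage) :
    History.epochData (Preorder.frestrictLe (π := fun _ => Stage) n ω) = epochData n ω := by
  have : Finset.Iic n = Finset.range (n + 1) := by ext; simp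
  simp only [History.epochData, epochData, History.last, eventTime, ← this]
  congr 1
  exact Finset.sum_coe_sort (Finset.Iic n) fun i => (ω i).1.1

namespace Service

instance (σ : Service) (π : Policy) (s₀ : ℕ) : IsProbabilityMeasure (σ.pathLaw π s₀) := by
  unfold pathLaw
  infer_instance

theorem map_pathLaw_succ (σ : Service) (π : Policy) (s₀ n : ℕ) :
    (σ.pathLaw π s₀).map (fun ω => (Preorder.frestrictLe (π := fun _ => Stage) n ω, ω (n + 1)))
      = ((σ.pathLaw π s₀).map (Preorder.frestrictLe (π := fun _ => Stage) n)) ⊗ₘ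
        σ.stepKernel π n :=
  Kernel.map_frestrictLe_trajMeasure_compProd_eq_map_trajMeasure.symm

theorem map_pathLaw_zero (σ : Service) (π : Policy) (s₀ : ℕ) :
    (σ.pathLaw π s₀).map (fun ω => ω 0) = initialLaw π s₀ := by
  have h1 : (fun ω : ℕ → Stage => ω 0)
      = (fun h : History 0 => h ⟨0, by simp⟩) ∘ Preorder.frestrictLe (π := fun _ => Stage) 0 := rfl
  rw [h1, ← Measure.map_map (by fun_prop) (by fun_prop), pathLaw, Kernel.trajMeasure,
    Measure.map_comp _ _ (by fun_prop), Kernel.traj_map_frestrictLe, Kernel.partialTraj_self,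
    Measure.id_comp, Measure.map_map (by fun_prop) (by fun_prop)]
  exact Measure.map_id

theorem fst_stepKernel (σ : Service) (π : Policy) (n : ℕ) (h : History n) :
    (σ.stepKernel π n h).map Prod.fst = σ.jumpKernel h.last := by
  have : (σ.stepKernel π n h).map Prod.fst = (σ.stepKernel π n).fst h := by
    rw [Kernel.fst_apply]
  rw [this, stepKernel, Kernel.fst_compProd, Kernel.comap_apply]

/-- However much of the past the policy uses, it affects the next wait and state only through the
current state and action. The next action is not seen by `f` and integrates out. -/
theorem lintegral_pathLaw_succ (σ : Service) (π : Policy) (s₀ n : ℕ)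
    {f : (ℝ × ℕ × Bool) × (ℝ × ℕ) → ℝ≥0∞} (hf : Measurable f) :
    ∫⁻ ω, f (epochData n ω, (ω (n + 1)).1) ∂σ.pathLaw π s₀
      = ∫⁻ ω, ∫⁻ y, f (epochData n ω, y) ∂σ.jumpKernel (epochData n ω).2 ∂σ.pathLaw π s₀ := by
  have hm := History.measurable_epochData (n := n)
  have hg : Measurable fun z : History n × Stage => f (History.epochData z.1, z.2.1) :=
    hf.comp (by fun_prop)
  calc ∫⁻ ω, f (epochData n ω, (ω (n + 1)).1) ∂σ.pathLaw π s₀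
      = ∫⁻ z, f (History.epochData z.1, z.2.1) ∂((σ.pathLaw π s₀).map
          fun ω => (Preorder.frestrictLe (π := fun _ => Stage) n ω, ω (n + 1))) := by
        rw [lintegral_map hg (by fun_prop)]
        simp_rw [epochData_frestrictLe]
    _ = ∫⁻ h, ∫⁻ x, f (History.epochData h, x.1) ∂σ.stepKernel π n h
          ∂((σ.pathLaw π s₀).map (Preorder.frestrictLe (π := fun _ => Stage) n)) := by
        rw [map_pathLaw_succ, Measure.lintegral_compProd hg]
    _ = ∫⁻ h, ∫⁻ y, f (History.epochData h, y) ∂σ.jumpKernel (History.epochData h).2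
          ∂((σ.pathLaw π s₀).map (Preorder.frestrictLe (π := fun _ => Stage) n)) := by
        congr with h
        have h2 : (History.epochData h).2 = History.last h := rfl
        rw [h2, ← fst_stepKernel σ π n h, lintegral_map (by fun_prop) measurable_fst]
    _ = _ := by
        rw [lintegral_map' _ (by fun_prop)]
        · simp_rw [epochData_frestrictLe]
        · have h3 : Measurable fun e : ℝ × ℕ × Bool => ∫⁻ y, f (e, y) ∂σ.jumpKernel e.2 :=
            hf.lintegral_kernel_prod_right' (κ := σ.jumpKernel.comap Prod.snd measurable_snd)
          exact (h3.comp hm).aemeasurable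

theorem jumpKernel_apply (σ : Service) (x : ℕ × Bool) :
    σ.jumpKernel x = (expMeasure (σ.totalRate x.1 x.2)).prod (σ.nextState x.1 x.2) := rfl

theorem ae_pathLaw_succ (σ : Service) (π : Policy) (s₀ n : ℕ)
    {p : (ℝ × ℕ × Bool) × (ℝ × ℕ) → Prop} (hp : MeasurableSet {z | p z})
    (h : ∀ᵐ ω ∂σ.pathLaw π s₀, ∀ᵐ y ∂σ.jumpKernel (epochData n ω).2, p (epochData n ω, y)) :
    ∀ᵐ ω ∂σ.pathLaw π s₀, p (epochData n ω, (ω (n + 1)).1) := by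
  have hd := measurable_epochData n
  have h1 := σ.lintegral_pathLaw_succ π s₀ n
    (f := {z | ¬ p z}.indicator 1) (measurable_one.indicator hp.compl)
  have h2 : ∫⁻ ω, ∫⁻ y, {z | ¬ p z}.indicator 1 (epochData n ω, y)
      ∂σ.jumpKernel (epochData n ω).2 ∂σ.pathLaw π s₀ = 0 := by
    rw [lintegral_congr_ae (g := fun _ => 0), lintegral_zero]
    filter_upwards [h] with ω hω
    rw [lintegral_congr_ae (g := fun _ => 0), lintegral_zero]
    filter_upwards [hω] with y hy
    simp [hy]
  rw [h2, lintegral_eq_zero_iff] at h1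
  · filter_upwards [h1] with ω hω
    by_contra hc
    simp [hc] at hω
  · exact (measurable_one.indicator hp.compl).comp (by fun_prop)

theorem ae_wait_pos (σ : Service) (π : Policy) (s₀ : ℕ) :
    ∀ᵐ ω ∂σ.pathLaw π s₀, ∀ n, 0 < (ω (n + 1)).1.1 := by
  rw [ae_all_iff]
  intro n
  refine σ.ae_pathLaw_succ π s₀ n (p := fun z => 0 < z.2.1)
    (measurableSet_lt (by fun_prop) (by fun_prop)) (ae_of_all _ fun ω => ?_)
  have := isProbabilityMeasure_expMeasure
    (σ.totalRate_pos (epochData n ω).2.1 (epochData n ω).2.2)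
  exact Measure.quasiMeasurePreserving_fst.ae (ae_pos_expMeasure (σ.totalRate_pos _ _))

theorem ae_initial (σ : Service) (π : Policy) (s₀ : ℕ) :
    ∀ᵐ ω ∂σ.pathLaw π s₀, (ω 0).1 = (0, s₀) := by
  have h : ∀ᵐ x ∂(σ.pathLaw π s₀).map (fun ω => ω 0), x.1 = (0, s₀) := by
    rw [map_pathLaw_zero, initialLaw]
    rw [ae_map_iff (measurable_of_countable _).aemeasurable
      (measurableSet_eq_fun (by fun_prop) (by fun_prop))]
    simp
  exact ae_of_ae_map (measurable_pi_apply 0).aemeasurable h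

/-- The death rate vanishes in state 0 and under passivity, so the truncated subtraction `0 - 1`
carries no mass. -/
theorem ae_nextState (σ : Service) {s : ℕ} {a : Bool} {p : ℕ → Prop} (h1 : p (s + 1))
    (h2 : a = true → s ≠ 0 → p (s - 1)) : ∀ᵐ s' ∂σ.nextState s a, p s' := by
  rw [nextState, ae_add_measure_iff]
  constructor
  · apply Measure.ae_smul_measure
    simpa [ae_dirac_iff (MeasurableSet.of_discrete : MeasurableSet {x | p x})] using h1
  · by_cases h : a = true ∧ s ≠ 0
    · apply Measure.ae_smul_measure
      simpa [ae_dirac_iff (MeasurableSet.of_discrete : MeasurableSet {x | p x})] using h2 h.1 h.2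
    · have : σ.deathRate s a = 0 := by
        rw [deathRate]
        split_ifs with ha
        · have : s = 0 := by tauto
          simp [this]
        · rfl
      simp [this]

/-- A property of states preserved by every transition whose starting point satisfies `q`. -/
theorem ae_state_induction (σ : Service) (π : Policy) (s₀ : ℕ) {p : ℕ → ℕ → Prop}
    {q : ℕ → Bool → Prop} (h0 : p 0 s₀) (hq : ∀ n, ∀ᵐ ω ∂σ.pathLaw π s₀, q (ω n).1.2 (ω n).2)
    (hup : ∀ n s a, p n s → q s a → p (n + 1) (s + 1))
    (hdown : ∀ n s, s ≠ 0 → p n s → q s true → p (n + 1) (s - 1)) (n : ℕ) :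
    ∀ᵐ ω ∂σ.pathLaw π s₀, p n (ω n).1.2 := by
  induction n with
  | zero =>
    filter_upwards [σ.ae_initial π s₀] with ω hω
    simpa [hω] using h0
  | succ n ih =>
    refine σ.ae_pathLaw_succ π s₀ n (p := fun z => p (n + 1) z.2.2)
      ((measurable_snd.comp measurable_snd)
        (MeasurableSet.of_discrete : MeasurableSet {s | p (n + 1) s})) ?_
    filter_upwards [ih, hq n] with ω hp hω
    have := isProbabilityMeasure_expMeasure
      (σ.totalRate_pos (epochData n ω).2.1 (epochData n ω).2.2)
    refine Measure.quasiMeasurePreserving_snd.ae (σ.ae_nextState (hup _ _ _ hp hω) ?_)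
    intro ha hs
    have ha : (ω n).2 = true := ha
    rw [ha] at hω
    exact hdown n _ hs hp hω

theorem ae_state_le (σ : Service) (π : Policy) (s₀ n : ℕ) :
    ∀ᵐ ω ∂σ.pathLaw π s₀, (ω n).1.2 ≤ s₀ + n :=
  σ.ae_state_induction π s₀ (p := fun n s => s ≤ s₀ + n) (q := fun _ _ => True) (by simp)
    (fun _ => by simp) (fun n s a h _ => by omega) (fun n s h h' _ => by omega) n

theorem ae_action_thresholdPolicy (σ : Service) (R : ℤ) (s₀ n : ℕ) :
    ∀ᵐ ω ∂σ.pathLaw (thresholdPolicy R) s₀, (ω n).2 = decide (R < ((ω n).1.2 : ℤ)) := by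
  have hm : MeasurableSet {x : Stage | x.2 = decide (R < (x.1.2 : ℤ))} :=
    measurableSet_eq_fun (by fun_prop)
      ((measurable_of_countable (fun s : ℕ => decide (R < (s : ℤ)))).comp (by fun_prop))
  cases n with
  | zero =>
    have h : ∀ᵐ x ∂(σ.pathLaw (thresholdPolicy R) s₀).map (fun ω => ω 0),
        x.2 = decide (R < (x.1.2 : ℤ)) := by
      rw [map_pathLaw_zero, initialLaw, ae_map_iff (measurable_of_countable _).aemeasurable hm]
      change ∀ᵐ x ∂(Kernel.deterministic (fun s : ℕ => decide (R < (s : ℤ)))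
        (measurable_of_countable _) s₀), _
      rw [Kernel.deterministic_apply, ae_dirac_iff (MeasurableSet.of_discrete)]
    exact ae_of_ae_map (measurable_pi_apply 0).aemeasurable h
  | succ n =>
    have h : ∀ᵐ z ∂(σ.pathLaw (thresholdPolicy R) s₀).map
        (fun ω => (Preorder.frestrictLe (π := fun _ => Stage) n ω, ω (n + 1))),
        z.2.2 = decide (R < (z.2.1.2 : ℤ)) := by
      rw [map_pathLaw_succ]
      refine Measure.ae_compProd_of_ae_ae (measurable_snd hm) (ae_of_all _ fun h => ?_)
      refine Kernel.ae_compProd_of_ae_ae hm (ae_of_all _ fun y => ?_)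
      have hd : (thresholdPolicy R).act n (h, y) = Measure.dirac (decide (R < (y.2 : ℤ))) :=
        Kernel.deterministic_apply
          ((measurable_of_countable (fun s : ℕ => decide (R < (s : ℤ)))).comp
            (measurable_snd.comp measurable_snd)) _
      rw [hd, ae_dirac_iff (MeasurableSet.of_discrete)]
    exact ae_of_ae_map (by fun_prop) h

end Service

/-! ### Non-explosion -/

namespace Service

/-- A wait of rate q multiplies the Laplace transform by q/(q + 1). Since the state grows by at most
1 per event, q + 1 is at most linear in n, and the divergent harmonic series will force the product
to 0. -/
theorem lintegral_exp_neg_eventTime_le (σ : Service) (π : Policy) (s₀ n : ℕ) :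
    ∫⁻ ω, ENNReal.ofReal (Real.exp (-eventTime ω n)) ∂σ.pathLaw π s₀
      ≤ ENNReal.ofReal (Real.exp (-((1 + σ.lam + σ.mu * (s₀ + 1))⁻¹
          * ∑ i ∈ Finset.range n, 1 / ((i : ℝ) + 1)))) := by
  have hl := σ.lam_pos
  have hu := σ.mu_pos
  induction n with
  | zero =>
    rw [lintegral_congr_ae (g := fun _ => 1)]
    · simp
    · filter_upwards [σ.ae_initial π s₀] with ω hω
      simp [eventTime, hω]
  | succ n ih =>
    set C := 1 + σ.lam + σ.mu * (s₀ + 1)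
    have hC : 0 < C := by positivity
    have h1 := σ.lintegral_pathLaw_succ π s₀ n
      (f := fun z => ENNReal.ofReal (Real.exp (-z.1.1)) * ENNReal.ofReal (Real.exp (-z.2.1)))
      (by fun_prop)
    have h2 : ∀ᵐ ω ∂σ.pathLaw π s₀,
        ∫⁻ y, ENNReal.ofReal (Real.exp (-(epochData n ω).1)) * ENNReal.ofReal (Real.exp (-y.1))
          ∂σ.jumpKernel (epochData n ω).2
        ≤ ENNReal.ofReal (Real.exp (-eventTime ω n))
          * ENNReal.ofReal (Real.exp (-(C⁻¹ * (1 / ((n : ℝ) + 1))))) := by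
      filter_upwards [σ.ae_state_le π s₀ n] with ω hω
      set s := (epochData n ω).2.1
      set a := (epochData n ω).2.2
      have hq := σ.totalRate_pos s a
      have := isProbabilityMeasure_expMeasure hq
      rw [lintegral_const_mul _ (by fun_prop), jumpKernel_apply, lintegral_prod _ (by fun_prop)]
      simp only [lintegral_const, measure_univ, mul_one]
      rw [lintegral_exp_neg_expMeasure hq]
      refine mul_le_mul_right (ENNReal.ofReal_le_ofReal ?_) _
      have hqle : σ.totalRate s a + 1 ≤ C * (n + 1) := by
        have h3 : (s : ℝ) ≤ s₀ + n := by exact_mod_cast hω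
        have h4 : σ.deathRate s a ≤ σ.mu * (s₀ + n) := by
          rw [deathRate]
          split_ifs
          · exact mul_le_mul_of_nonneg_left h3 hu.le
          · positivity
        have h5 : σ.totalRate s a = σ.lam + σ.deathRate s a := rfl
        have h6 : 0 ≤ σ.mu * s₀ * n := by positivity
        have h7 : 0 ≤ (n : ℝ) := by positivity
        simp only [C]
        nlinarith
      calc σ.totalRate s a / (σ.totalRate s a + 1) = 1 - 1 / (σ.totalRate s a + 1) := by
            field_simp
            ring
        _ ≤ 1 - 1 / (C * (n + 1)) := by gcongr
        _ = -(C⁻¹ * (1 / ((n : ℝ) + 1))) + 1 := by field_simp; ring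
        _ ≤ _ := Real.add_one_le_exp _
    calc ∫⁻ ω, ENNReal.ofReal (Real.exp (-eventTime ω (n + 1))) ∂σ.pathLaw π s₀
        = ∫⁻ ω, ENNReal.ofReal (Real.exp (-(epochData n ω).1))
            * ENNReal.ofReal (Real.exp (-(ω (n + 1)).1.1)) ∂σ.pathLaw π s₀ := by
          congr with ω
          rw [← ENNReal.ofReal_mul (Real.exp_pos _).le, ← Real.exp_add, eventTime_succ, epochData]
          ring_nf
      _ ≤ ∫⁻ ω, ENNReal.ofReal (Real.exp (-eventTime ω n))
          * ENNReal.ofReal (Real.exp (-(C⁻¹ * (1 / ((n : ℝ) + 1))))) ∂σ.pathLaw π s₀ := by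
          rw [h1]
          exact lintegral_mono_ae h2
      _ ≤ _ := by
          rw [lintegral_mul_const _ (by have := measurable_eventTime n; fun_prop)]
          refine (mul_le_mul_left ih _).trans_eq ?_
          rw [← ENNReal.ofReal_mul (Real.exp_pos _).le, ← Real.exp_add, Finset.sum_range_succ]
          ring_nf

theorem tendsto_measure_eventTime_le (σ : Service) (π : Policy) (s₀ : ℕ) (T : ℝ) :
    Tendsto (fun n => σ.pathLaw π s₀ {ω | eventTime ω n ≤ T}) atTop (nhds 0) := by
  have hl := σ.lam_pos
  have hu := σ.mu_pos
  set C := 1 + σ.lam + σ.mu * (s₀ + 1)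
  have hC : 0 < C := by positivity
  have hlim : Tendsto (fun n => ENNReal.ofReal (Real.exp T) * ENNReal.ofReal (Real.exp (-(C⁻¹
      * ∑ i ∈ Finset.range n, 1 / ((i : ℝ) + 1))))) atTop (nhds 0) := by
    have h1 : Tendsto (fun n : ℕ => Real.exp (-(C⁻¹
      * ∑ i ∈ Finset.range n, 1 / ((i : ℝ) + 1)))) atTop (nhds 0) :=
      Real.tendsto_exp_neg_atTop_nhds_zero.comp
        (Real.tendsto_sum_range_one_div_nat_succ_atTop.const_mul_atTop (by positivity))
    have h2 := ENNReal.Tendsto.const_mul (a := ENNReal.ofReal (Real.exp T))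
      (ENNReal.tendsto_ofReal h1) (Or.inr ENNReal.ofReal_ne_top)
    simpa using h2
  refine tendsto_of_tendsto_of_tendsto_of_le_of_le tendsto_const_nhds hlim (fun _ => zero_le)
    fun n => ?_
  have hm := measurable_eventTime n
  have h1 := mul_meas_ge_le_lintegral (μ := σ.pathLaw π s₀)
    (f := fun ω => ENNReal.ofReal (Real.exp (-eventTime ω n))) (by fun_prop)
    (ENNReal.ofReal (Real.exp (-T)))
  calc σ.pathLaw π s₀ {ω | eventTime ω n ≤ T}
      = ENNReal.ofReal (Real.exp T) * (ENNReal.ofReal (Real.exp (-T))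
          * σ.pathLaw π s₀ {ω | eventTime ω n ≤ T}) := by
        rw [← mul_assoc, ← ENNReal.ofReal_mul (Real.exp_pos _).le, ← Real.exp_add]
        simp
    _ ≤ _ := by
        refine mul_le_mul_right (le_trans ?_ (σ.lintegral_exp_neg_eventTime_le π s₀ n)) _
        refine le_trans (mul_le_mul_right (measure_mono fun ω hω => ?_) _) h1
        exact ENNReal.ofReal_le_ofReal (Real.exp_le_exp.2 (neg_le_neg hω))

theorem ae_exists_lt_eventTime (σ : Service) (π : Policy) (s₀ : ℕ) :
    ∀ᵐ ω ∂σ.pathLaw π s₀, ∀ T : ℝ, ∃ n, T < eventTime ω n := by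
  have h : ∀ᵐ ω ∂σ.pathLaw π s₀, ∀ m : ℕ, ∃ n, (m : ℝ) < eventTime ω n := by
    rw [ae_all_iff]
    intro m
    rw [ae_iff]
    refine le_antisymm (ge_of_tendsto' (σ.tendsto_measure_eventTime_le π s₀ m) fun n => ?_) zero_le
    refine measure_mono fun ω hω => ?_
    simp only [not_exists, not_lt, Set.mem_ofPred_eq] at hω
    exact hω n
  filter_upwards [h] with ω hω T
  obtain ⟨m, hm⟩ := exists_nat_ge T
  obtain ⟨n, hn⟩ := hω m
  exact ⟨n, hm.trans_lt hn⟩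

end Service

/-! ### Time integrals as sums over epochs -/

/-- Starting at time `0`, event times increase strictly and without bound. -/
structure RegularPath (ω : ℕ → Stage) : Prop where
  init : (ω 0).1.1 = 0
  wait_pos : ∀ n, 0 < (ω (n + 1)).1.1
  unbounded : ∀ T : ℝ, ∃ n, T < eventTime ω n

theorem Service.ae_regularPath (σ : Service) (π : Policy) (s₀ : ℕ) :
    ∀ᵐ ω ∂σ.pathLaw π s₀, RegularPath ω := by
  filter_upwards [σ.ae_initial π s₀, σ.ae_wait_pos π s₀, σ.ae_exists_lt_eventTime π s₀]
    with ω h1 h2 h3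
  exact ⟨by rw [h1], h2, h3⟩

namespace RegularPath

variable {ω : ℕ → Stage}

theorem eventTime_zero (h : RegularPath ω) : eventTime ω 0 = 0 := by
  simp [eventTime, h.init]

theorem strictMono_eventTime (h : RegularPath ω) : StrictMono (eventTime ω) :=
  strictMono_nat_of_lt_succ fun n => by
    rw [eventTime_succ]
    linarith [h.wait_pos n]

theorem eventTime_nonneg (h : RegularPath ω) (n : ℕ) : 0 ≤ eventTime ω n :=
  h.eventTime_zero ▸ h.strictMono_eventTime.monotone (Nat.zero_le n)

theorem mem_Ico_eventTime_iff (h : RegularPath ω) {t : ℝ} (ht : 0 ≤ t) (n : ℕ) :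
    t ∈ Set.Ico (eventTime ω n) (eventTime ω (n + 1)) ↔ n = eventCount ω t := by
  have hne : {n : ℕ | t < eventTime ω (n + 1)}.Nonempty := by
    obtain ⟨n, hn⟩ := h.unbounded t
    exact ⟨n, hn.trans (h.strictMono_eventTime (Nat.lt_succ_self n))⟩
  constructor
  · rintro ⟨h1, h2⟩
    refine le_antisymm ?_ (Nat.sInf_le h2)
    by_contra hlt
    push Not at hlt
    have h3 : t < eventTime ω (eventCount ω t + 1) := Nat.sInf_mem hne
    have h4 := h.strictMono_eventTime.monotone (Nat.succ_le_of_lt hlt)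
    exact absurd (h3.trans_le (h4.trans h1)) (lt_irrefl _)
  · rintro rfl
    refine ⟨?_, Nat.sInf_mem hne⟩
    rcases hn : eventCount ω t with _ | m
    · rw [h.eventTime_zero]
      exact ht
    · by_contra hlt
      have := Nat.sInf_le (s := {n : ℕ | t < eventTime ω (n + 1)}) (not_le.1 hlt)
      change eventCount ω t ≤ m at this
      omega

/-- The intervals between events partition [0, ∞). After the horizon the length is negative and
`ENNReal.ofReal` sends it to 0. -/
theorem lintegral_eventCount (h : RegularPath ω) (f : ℕ → ℝ≥0∞) (T : ℝ) :
    ∫⁻ t in Set.Ioc 0 T, f (eventCount ω t)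
      = ∑' n, f n * ENNReal.ofReal (min (ω (n + 1)).1.1 (T - eventTime ω n)) := by
  have h1 : ∀ t ∈ Set.Ioc 0 T, f (eventCount ω t)
      = ∑' n, f n * (Set.Ico (eventTime ω n) (eventTime ω (n + 1))).indicator 1 t := by
    intro t ht
    rw [tsum_eq_single (eventCount ω t)]
    · rw [Set.indicator_of_mem ((h.mem_Ico_eventTime_iff ht.1.le _).2 rfl), Pi.one_apply, mul_one]
    · intro n hn
      rw [Set.indicator_of_notMem (fun hc => hn ((h.mem_Ico_eventTime_iff ht.1.le _).1 hc)),
        mul_zero]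
  rw [setLIntegral_congr_fun measurableSet_Ioc h1, lintegral_tsum fun n =>
    ((measurable_one.indicator measurableSet_Ico).const_mul _).aemeasurable]
  congr with n
  rw [lintegral_const_mul _ (measurable_one.indicator measurableSet_Ico),
    lintegral_indicator_one measurableSet_Ico,
    measure_congr (Ico_ae_eq_Ioc' (by simp) (by simp)), Measure.restrict_apply measurableSet_Ioc,
    Set.Ioc_inter_Ioc, Real.volume_Ioc, max_eq_left (h.eventTime_nonneg n), eventTime_succ]
  congr 2
  rw [← min_sub_sub_right]
  ring_nf

end RegularPath

/-! ### Occupation integrals and the shifted cost -/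

namespace Service

/-- The expected integral up to time `T` of a function of state and action. -/
noncomputable def occupation (σ : Service) (π : Policy) (s₀ : ℕ) (T : ℝ) (f : ℕ → Bool → ℝ≥0∞) :
    ℝ≥0∞ :=
  ∑' n, ∫⁻ ω, f (ω n).1.2 (ω n).2 * ENNReal.ofReal (min (ω (n + 1)).1.1 (T - eventTime ω n))
    ∂σ.pathLaw π s₀

theorem measurable_epoch_fun (f : ℕ → Bool → ℝ≥0∞) (n : ℕ) :
    Measurable fun ω : ℕ → Stage => f (ω n).1.2 (ω n).2 :=
  (measurable_of_countable fun x : ℕ × Bool => f x.1 x.2).comp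
    (by fun_prop : Measurable fun ω : ℕ → Stage => ((ω n).1.2, (ω n).2))

theorem lintegral_stateAt_actionAt (σ : Service) (π : Policy) (s₀ : ℕ) (T : ℝ)
    (f : ℕ → Bool → ℝ≥0∞) :
    ∫⁻ ω, (∫⁻ t in Set.Ioc 0 T, f (stateAt ω t) (actionAt ω t)) ∂σ.pathLaw π s₀
      = σ.occupation π s₀ T f := by
  rw [occupation, ← lintegral_tsum fun n => by
    have := measurable_eventTime n
    have := measurable_epoch_fun f n
    fun_prop]
  refine lintegral_congr_ae ?_
  filter_upwards [σ.ae_regularPath π s₀] with ω hω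
  exact hω.lintegral_eventCount (fun n => f (ω n).1.2 (ω n).2) T

theorem occupation_const (σ : Service) (π : Policy) (s₀ : ℕ) (T : ℝ) (c : ℝ≥0∞) :
    σ.occupation π s₀ T (fun _ _ => c) = c * ENNReal.ofReal T := by
  rw [← lintegral_stateAt_actionAt]
  simp

theorem occupation_mono (σ : Service) (π : Policy) (s₀ : ℕ) (T : ℝ) {f g : ℕ → Bool → ℝ≥0∞}
    (h : ∀ s a, f s a ≤ g s a) : σ.occupation π s₀ T f ≤ σ.occupation π s₀ T g :=
  ENNReal.tsum_le_tsum fun _ => lintegral_mono fun _ => mul_le_mul_left (h _ _) _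

theorem occupation_add (σ : Service) (π : Policy) (s₀ : ℕ) (T : ℝ) (f g : ℕ → Bool → ℝ≥0∞) :
    σ.occupation π s₀ T (fun s a => f s a + g s a)
      = σ.occupation π s₀ T f + σ.occupation π s₀ T g := by
  rw [occupation, occupation, occupation, ← ENNReal.tsum_add]
  congr with n
  have := measurable_eventTime n
  have := measurable_epoch_fun f n
  rw [← lintegral_add_left (by fun_prop)]
  simp_rw [add_mul]

/-- The running cost shifted by the subsidy is nonnegative. -/
theorem shiftedCost_nonneg (σ : Service) {W : ℝ} (hW : 0 ≤ W) (s : ℕ) (a : Bool) :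
    0 ≤ σ.runningCost W s a + W := by
  have := σ.lam_pos
  have h : 0 ≤ (s : ℝ) / σ.lam := by positivity
  cases a <;> simp [runningCost] <;> linarith

theorem expectedCost_eq (σ : Service) {W : ℝ} (hW : 0 ≤ W) (π : Policy) (s₀ : ℕ) {T : ℝ}
    (hT : 0 ≤ T) :
    σ.expectedCost W π s₀ T
      = (σ.occupation π s₀ T (fun s a => ENNReal.ofReal (σ.runningCost W s a + W)) : EReal)
        - ((W * T : ℝ) : EReal) := by
  rw [expectedCost, σ.lintegral_stateAt_actionAt π s₀ T
      fun s a => ENNReal.ofReal (σ.runningCost W s a),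
    σ.lintegral_stateAt_actionAt π s₀ T fun s a => ENNReal.ofReal (-σ.runningCost W s a)]
  set A := σ.occupation π s₀ T fun s a => ENNReal.ofReal (σ.runningCost W s a)
  set B := σ.occupation π s₀ T fun s a => ENNReal.ofReal (-σ.runningCost W s a) with hB
  set C := σ.occupation π s₀ T fun s a => ENNReal.ofReal (σ.runningCost W s a + W)
  have hw : σ.occupation π s₀ T (fun _ _ => ENNReal.ofReal W) = ENNReal.ofReal (W * T) := by
    rw [occupation_const, ENNReal.ofReal_mul hW]
  have hBtop : B ≠ ⊤ := by
    refine ne_top_of_le_ne_top (b := ENNReal.ofReal (W * T)) ENNReal.ofReal_ne_top ?_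
    rw [← hw]
    refine σ.occupation_mono π s₀ T fun s a => ENNReal.ofReal_le_ofReal ?_
    linarith [σ.shiftedCost_nonneg hW s a]
  -- Pointwise, positive part + W = negative part + (cost + W). Stated without subtraction, this
  -- survives A = C = ∞.
  have hsum : A + ENNReal.ofReal (W * T) = B + C := by
    rw [← hw, ← occupation_add, ← occupation_add]
    congr 1
    ext s a : 2
    have h := σ.shiftedCost_nonneg hW s a
    rcases le_total 0 (σ.runningCost W s a) with hc | hc
    · rw [ENNReal.ofReal_of_nonpos (neg_nonpos.2 hc), zero_add, ENNReal.ofReal_add hc hW]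
    · rw [ENNReal.ofReal_of_nonpos hc, zero_add, ← ENNReal.ofReal_add (neg_nonneg.2 hc) h]
      congr 1
      ring
  have hWT : 0 ≤ W * T := by positivity
  generalize A = A at *
  generalize C = C at *
  clear hB
  generalize B = B at *
  lift B to NNReal using hBtop
  by_cases hC : C = ⊤
  · have hA : A = ⊤ := by
      rw [hC, add_top] at hsum
      simpa using hsum
    rw [hA, hC, EReal.coe_ennreal_top, EReal.top_sub_coe]
    exact EReal.top_sub_coe (B : ℝ)
  · have hA : A ≠ ⊤ := by
      rintro rfl
      rw [top_add] at hsum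
      exact hC (by simpa using hsum.symm)
    lift A to NNReal using hA
    lift C to NNReal using hC
    have h1 := congrArg ENNReal.toReal hsum
    rw [ENNReal.toReal_add (by simp) (by simp), ENNReal.toReal_add (by simp) (by simp),
      ENNReal.toReal_ofReal hWT] at h1
    simp only [ENNReal.coe_toReal] at h1
    change ((A : ℝ) : EReal) - ((B : ℝ) : EReal) = ((C : ℝ) : EReal) - _
    rw [← EReal.coe_sub, ← EReal.coe_sub]
    congr 1
    linarith

end Service

/-! ### Verification: from Bellman inequalities to average costs -/

namespace Service

/-- The expected potential at the `n`-th epoch, with horizon `T`. -/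
noncomputable def expectedPotential (σ : Service) (π : Policy) (s₀ : ℕ) (T G : ℝ) (h : ℕ → ℝ)
    (n : ℕ) : ℝ≥0∞ :=
  ∫⁻ ω, potential G h (T - eventTime ω n) (ω n).1.2 ∂σ.pathLaw π s₀

theorem expectedPotential_zero (σ : Service) (π : Policy) (s₀ : ℕ) {T G : ℝ} (hT : 0 ≤ T)
    (hG : 0 ≤ G) {h : ℕ → ℝ} (hh : ∀ s, 0 ≤ h s) :
    σ.expectedPotential π s₀ T G h 0 = ENNReal.ofReal (G * T + h s₀) := by
  rw [expectedPotential, lintegral_congr_ae (g := fun _ => ENNReal.ofReal (G * T + h s₀))]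
  · simp
  · filter_upwards [σ.ae_initial π s₀] with ω hω
    have h0 : eventTime ω 0 = 0 := by simp [eventTime, hω]
    rw [h0, sub_zero, hω, potential_of_nonneg hG hh hT]

theorem measurable_epoch_potential (T G : ℝ) (h : ℕ → ℝ) (n : ℕ) :
    Measurable fun ω : ℕ → Stage => potential G h (T - eventTime ω n) (ω n).1.2 := by
  have := measurable_eventTime n
  exact (measurable_potential G h).comp
    (by fun_prop : Measurable fun ω : ℕ → Stage => (T - eventTime ω n, (ω n).1.2))

theorem measurable_shiftedCost (σ : Service) (W : ℝ) :
    Measurable fun x : ℕ × Bool => ENNReal.ofReal (σ.runningCost W x.1 x.2 + W) :=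
  measurable_of_countable _

/-- Cost between the `n`-th and the next epoch plus the potential at the next epoch, as a function
of the data of the `n`-th epoch and of the jump. -/
noncomputable def stepCost (σ : Service) (W T G : ℝ) (h : ℕ → ℝ)
    (z : (ℝ × ℕ × Bool) × (ℝ × ℕ)) : ℝ≥0∞ :=
  ENNReal.ofReal (σ.runningCost W z.1.2.1 z.1.2.2 + W) * ENNReal.ofReal (min z.2.1 (T - z.1.1))
    + potential G h (T - z.1.1 - z.2.1) z.2.2

theorem measurable_stepCost (σ : Service) (W T G : ℝ) (h : ℕ → ℝ) :
    Measurable (σ.stepCost W T G h) := by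
  have h1 := σ.measurable_shiftedCost W
  have h2 := (measurable_potential G h).comp (by fun_prop :
    Measurable fun z : (ℝ × ℕ × Bool) × (ℝ × ℕ) => (T - z.1.1 - z.2.1, z.2.2))
  exact ((h1.comp (by fun_prop : Measurable fun z : (ℝ × ℕ × Bool) × (ℝ × ℕ) => z.1.2)).mul
    (by fun_prop)).add h2

theorem lintegral_stepCost (σ : Service) (W : ℝ) (π : Policy) (s₀ : ℕ) (T G : ℝ) (h : ℕ → ℝ)
    (n : ℕ) :
    ∫⁻ ω, σ.stepCost W T G h (epochData n ω, (ω (n + 1)).1) ∂σ.pathLaw π s₀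
      = ∫⁻ ω, ENNReal.ofReal (σ.runningCost W (ω n).1.2 (ω n).2 + W)
          * ENNReal.ofReal (min (ω (n + 1)).1.1 (T - eventTime ω n)) ∂σ.pathLaw π s₀
        + σ.expectedPotential π s₀ T G h (n + 1) := by
  rw [expectedPotential, ← lintegral_add_right _ (measurable_epoch_potential T G h (n + 1))]
  congr with ω
  rw [stepCost, eventTime_succ, ← sub_sub]
  rfl

theorem occupation_le_of_supersolution (σ : Service) {W G : ℝ} (hW : 0 ≤ W) (hG : 0 ≤ G)
    (π : Policy) (s₀ : ℕ) {h : ℕ → ℝ} (hh : ∀ s, 0 ≤ h s) {p : ℕ → Bool → Prop}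
    (hp : ∀ n, ∀ᵐ ω ∂σ.pathLaw π s₀, p (ω n).1.2 (ω n).2)
    (hle : ∀ s a, p s a →
      σ.runningCost W s a + W - G + σ.totalRate s a * (σ.nextMean h s a - h s) ≤ 0)
    {T : ℝ} (hT : 0 ≤ T) :
    σ.occupation π s₀ T (fun s a => ENNReal.ofReal (σ.runningCost W s a + W))
      ≤ ENNReal.ofReal (G * T + h s₀) := by
  have hstep : ∀ n, ∫⁻ ω, ENNReal.ofReal (σ.runningCost W (ω n).1.2 (ω n).2 + W)
        * ENNReal.ofReal (min (ω (n + 1)).1.1 (T - eventTime ω n)) ∂σ.pathLaw π s₀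
      + σ.expectedPotential π s₀ T G h (n + 1) ≤ σ.expectedPotential π s₀ T G h n := by
    intro n
    rw [← lintegral_stepCost, σ.lintegral_pathLaw_succ π s₀ n (σ.measurable_stepCost W T G h)]
    refine lintegral_mono_ae ?_
    filter_upwards [hp n] with ω hω
    exact σ.potential_step_le (σ.shiftedCost_nonneg hW _ _) hG hh _ _ (hle _ _ hω) _
  rw [occupation, ← σ.expectedPotential_zero π s₀ hT hG hh]
  refine ENNReal.tsum_le_of_sum_range_le fun n => ?_
  suffices H : ∀ n, ∑ i ∈ Finset.range n,
      ∫⁻ ω, ENNReal.ofReal (σ.runningCost W (ω i).1.2 (ω i).2 + W)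
        * ENNReal.ofReal (min (ω (i + 1)).1.1 (T - eventTime ω i)) ∂σ.pathLaw π s₀
      + σ.expectedPotential π s₀ T G h n ≤ σ.expectedPotential π s₀ T G h 0 from
    le_self_add.trans (H n)
  intro n
  induction n with
  | zero => simp
  | succ n ih =>
    rw [Finset.sum_range_succ, add_assoc]
    exact (add_le_add_right (hstep n) _).trans ih

/-- The potential is bounded and vanishes once the event time exceeds T, so non-explosion applies;
the bound `H` on `h` is essential to this estimate. -/
theorem tendsto_expectedPotential (σ : Service) (π : Policy) (s₀ : ℕ) {T G H : ℝ}
    (hG : 0 ≤ G) {h : ℕ → ℝ} (hh : ∀ s, 0 ≤ h s) (hH : ∀ s, h s ≤ H) :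
    Tendsto (σ.expectedPotential π s₀ T G h) atTop (nhds 0) := by
  have hlim : Tendsto (fun n => ENNReal.ofReal (G * T + H)
      * σ.pathLaw π s₀ {ω | eventTime ω n ≤ T}) atTop (nhds 0) := by
    simpa using ENNReal.Tendsto.const_mul (a := ENNReal.ofReal (G * T + H))
      (σ.tendsto_measure_eventTime_le π s₀ T) (Or.inr ENNReal.ofReal_ne_top)
  refine tendsto_of_tendsto_of_tendsto_of_le_of_le tendsto_const_nhds hlim (fun _ => zero_le)
    fun n => ?_
  have hm : MeasurableSet {ω : ℕ → Stage | eventTime ω n ≤ T} :=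
    measurableSet_le (measurable_eventTime n) measurable_const
  simp only
  rw [← lintegral_indicator_one hm, ← lintegral_const_mul _ (measurable_one.indicator hm)]
  refine lintegral_mono_ae ?_
  filter_upwards [σ.ae_regularPath π s₀] with ω hω
  rcases le_or_gt (eventTime ω n) T with hn | hn
  · rw [potential_of_nonneg hG hh (sub_nonneg.2 hn), Set.indicator_of_mem (by exact hn),
      Pi.one_apply, mul_one]
    refine ENNReal.ofReal_le_ofReal (add_le_add (mul_le_mul_of_nonneg_left ?_ hG) (hH _))
    linarith [hω.eventTime_nonneg n]
  · rw [potential_of_neg _ _ (sub_neg.2 hn)]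
    exact zero_le

theorem le_occupation_of_subsolution (σ : Service) {W G H : ℝ} (hW : 0 ≤ W) (hG : 0 ≤ G)
    (π : Policy) (s₀ : ℕ) {h : ℕ → ℝ} (hh : ∀ s, 0 ≤ h s) (hH : ∀ s, h s ≤ H)
    {p : ℕ → Bool → Prop} (hp : ∀ n, ∀ᵐ ω ∂σ.pathLaw π s₀, p (ω n).1.2 (ω n).2)
    (hle : ∀ s a, p s a →
      0 ≤ σ.runningCost W s a + W - G + σ.totalRate s a * (σ.nextMean h s a - h s))
    {T : ℝ} (hT : 0 ≤ T) :
    ENNReal.ofReal (G * T + h s₀) ≤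
      σ.occupation π s₀ T (fun s a => ENNReal.ofReal (σ.runningCost W s a + W))
        + ENNReal.ofReal H := by
  set a : ℕ → ℝ≥0∞ := fun n => ∫⁻ ω, ENNReal.ofReal (σ.runningCost W (ω n).1.2 (ω n).2 + W)
        * ENNReal.ofReal (min (ω (n + 1)).1.1 (T - eventTime ω n)) ∂σ.pathLaw π s₀ with ha
  set u : ℕ → ℝ≥0∞ := fun n =>
    ∫⁻ ω, (Set.Ico (eventTime ω n) (eventTime ω (n + 1))).indicator 1 T ∂σ.pathLaw π s₀ with hu
  have hmu : ∀ n, Measurable fun ω : ℕ → Stage =>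
      (Set.Ico (eventTime ω n) (eventTime ω (n + 1))).indicator (1 : ℝ → ℝ≥0∞) T := by
    intro n
    have hm : MeasurableSet {ω : ℕ → Stage | eventTime ω n ≤ T ∧ T < eventTime ω (n + 1)} :=
      (measurableSet_le (measurable_eventTime n) measurable_const).inter
        (measurableSet_lt measurable_const (measurable_eventTime (n + 1)))
    exact (measurable_one.indicator hm : Measurable (Set.indicator _ (1 : (ℕ → Stage) → ℝ≥0∞)))
  have hstep : ∀ n, σ.expectedPotential π s₀ T G h n
      ≤ a n + σ.expectedPotential π s₀ T G h (n + 1) + ENNReal.ofReal H * u n := by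
    intro n
    have hI : Measurable fun z : (ℝ × ℕ × Bool) × (ℝ × ℕ) => ENNReal.ofReal H
        * (Set.Ici (0 : ℝ)).indicator 1 (T - z.1.1)
        * (Set.Ioi (T - z.1.1)).indicator (1 : ℝ → ℝ≥0∞) z.2.1 := by
      have h1 : Measurable fun z : (ℝ × ℕ × Bool) × (ℝ × ℕ) =>
          (Set.Ici (0 : ℝ)).indicator (1 : ℝ → ℝ≥0∞) (T - z.1.1) :=
        (measurable_one.indicator measurableSet_Ici).comp (by fun_prop)
      have hm : MeasurableSet {z : (ℝ × ℕ × Bool) × (ℝ × ℕ) | T - z.1.1 < z.2.1} :=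
        measurableSet_lt (by fun_prop) (by fun_prop)
      have h2 : Measurable fun z : (ℝ × ℕ × Bool) × (ℝ × ℕ) =>
          (Set.Ioi (T - z.1.1)).indicator (1 : ℝ → ℝ≥0∞) z.2.1 :=
        (measurable_one.indicator hm :
          Measurable (Set.indicator _ (1 : (ℝ × ℕ × Bool) × (ℝ × ℕ) → ℝ≥0∞)))
      fun_prop
    have h1 := σ.lintegral_pathLaw_succ π s₀ n ((σ.measurable_stepCost W T G h).add hI)
    have h2 : ∫⁻ ω, (σ.stepCost W T G h + fun z : (ℝ × ℕ × Bool) × (ℝ × ℕ) => ENNReal.ofReal H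
        * (Set.Ici (0 : ℝ)).indicator 1 (T - z.1.1)
        * (Set.Ioi (T - z.1.1)).indicator (1 : ℝ → ℝ≥0∞) z.2.1)
          (epochData n ω, (ω (n + 1)).1) ∂σ.pathLaw π s₀
        = a n + σ.expectedPotential π s₀ T G h (n + 1) + ENNReal.ofReal H * u n := by
      rw [ha, hu]
      simp only
      rw [← lintegral_stepCost, ← lintegral_const_mul _ (hmu n),
        ← lintegral_add_right _ ((hmu n).const_mul _)]
      congr with ω
      rw [Pi.add_apply, mul_assoc]
      congr 2
      simp only [epochData, eventTime_succ, Set.indicator, Set.mem_Ici, Set.mem_Ioi, Set.mem_Ico,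
        sub_nonneg, sub_lt_iff_lt_add']
      by_cases h3 : eventTime ω n ≤ T <;> simp [h3]
    rw [← h2, h1]
    refine lintegral_mono_ae ?_
    filter_upwards [hp n] with ω hω
    exact σ.le_potential_step (σ.shiftedCost_nonneg hW _ _) hG hh hH _ _ (hle _ _ hω) _
  have hsum : ∀ n, σ.expectedPotential π s₀ T G h 0
      ≤ ∑ i ∈ Finset.range n, a i + σ.expectedPotential π s₀ T G h n
        + ENNReal.ofReal H * ∑ i ∈ Finset.range n, u i := by
    intro n
    induction n with
    | zero => simp
    | succ n ih =>
      refine (ih.trans (add_le_add_left (add_le_add_right (hstep n) _) _)).trans_eq ?_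
      rw [Finset.sum_range_succ, Finset.sum_range_succ]
      ring
  -- Exactly one interval between events straddles T, so the charge `H` is paid once in total.
  have hone : ∑' n, u n = 1 := by
    rw [hu, ← lintegral_tsum fun n => (hmu n).aemeasurable,
      lintegral_congr_ae (g := fun _ => 1)]
    · simp
    · filter_upwards [σ.ae_regularPath π s₀] with ω hω
      rw [tsum_eq_single (eventCount ω T)]
      · rw [Set.indicator_of_mem ((hω.mem_Ico_eventTime_iff hT _).2 rfl), Pi.one_apply]
      · intro n hn
        rw [Set.indicator_of_notMem fun hc => hn ((hω.mem_Ico_eventTime_iff hT _).1 hc)]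
  rw [← σ.expectedPotential_zero π s₀ hT hG hh]
  have hlim : Tendsto (fun n => ∑' i, a i + σ.expectedPotential π s₀ T G h n + ENNReal.ofReal H)
      atTop (nhds (∑' i, a i + 0 + ENNReal.ofReal H)) :=
    ((tendsto_const_nhds).add (σ.tendsto_expectedPotential π s₀ hG hh hH)).add
      tendsto_const_nhds
  rw [add_zero] at hlim
  refine ge_of_tendsto' hlim fun n => (hsum n).trans ?_
  refine add_le_add (add_le_add_left (ENNReal.sum_le_tsum _) _) ?_
  refine (mul_le_mul_right (ENNReal.sum_le_tsum _) _).trans_eq ?_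
  rw [hone, mul_one]

theorem averageCost_le_of_supersolution (σ : Service) {W G : ℝ} (hW : 0 ≤ W) (hG : 0 ≤ G)
    (π : Policy) (s₀ : ℕ) {h : ℕ → ℝ} (hh : ∀ s, 0 ≤ h s) {p : ℕ → Bool → Prop}
    (hp : ∀ n, ∀ᵐ ω ∂σ.pathLaw π s₀, p (ω n).1.2 (ω n).2)
    (hle : ∀ s a, p s a →
      σ.runningCost W s a + W - G + σ.totalRate s a * (σ.nextMean h s a - h s) ≤ 0) :
    σ.averageCost W π s₀ ≤ ((G - W : ℝ) : EReal) := by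
  have hlim : Tendsto (fun T : ℝ => ((G - W + h s₀ * T⁻¹ : ℝ) : EReal)) atTop
      (nhds ((G - W : ℝ) : EReal)) := by
    refine (continuous_coe_real_ereal.tendsto _).comp ?_
    simpa using (tendsto_inv_atTop_zero.const_mul (h s₀)).const_add (G - W)
  rw [averageCost, ← hlim.limsup_eq]
  refine limsup_le_limsup ?_
  filter_upwards [eventually_gt_atTop (0 : ℝ)] with T hT
  have h1 := σ.occupation_le_of_supersolution hW hG π s₀ hh hp hle hT.le
  have h2 : 0 ≤ G * T + h s₀ := add_nonneg (by positivity) (hh s₀)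
  have h3 : σ.expectedCost W π s₀ T ≤ ((G * T + h s₀ - W * T : ℝ) : EReal) := by
    rw [σ.expectedCost_eq hW π s₀ hT.le, EReal.coe_sub]
    refine EReal.sub_le_sub ?_ le_rfl
    refine (EReal.coe_ennreal_le_coe_ennreal_iff.2 h1).trans_eq ?_
    rw [EReal.coe_ennreal_ofReal, max_eq_left h2]
  refine (mul_le_mul_of_nonneg_left h3 (by exact_mod_cast (inv_pos.2 hT).le)).trans_eq ?_
  rw [← EReal.coe_mul]
  congr 1
  field_simp
  ring

theorem le_averageCost_of_subsolution (σ : Service) {W G H : ℝ} (hW : 0 ≤ W) (hG : 0 ≤ G)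
    (π : Policy) (s₀ : ℕ) {h : ℕ → ℝ} (hh : ∀ s, 0 ≤ h s) (hH : ∀ s, h s ≤ H)
    {p : ℕ → Bool → Prop} (hp : ∀ n, ∀ᵐ ω ∂σ.pathLaw π s₀, p (ω n).1.2 (ω n).2)
    (hle : ∀ s a, p s a →
      0 ≤ σ.runningCost W s a + W - G + σ.totalRate s a * (σ.nextMean h s a - h s)) :
    ((G - W : ℝ) : EReal) ≤ σ.averageCost W π s₀ := by
  have hlim : Tendsto (fun T : ℝ => ((G - W + (h s₀ - H) * T⁻¹ : ℝ) : EReal)) atTop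
      (nhds ((G - W : ℝ) : EReal)) := by
    refine (continuous_coe_real_ereal.tendsto _).comp ?_
    simpa using (tendsto_inv_atTop_zero.const_mul (h s₀ - H)).const_add (G - W)
  rw [averageCost, ← hlim.limsup_eq]
  refine limsup_le_limsup ?_
  filter_upwards [eventually_gt_atTop (0 : ℝ)] with T hT
  have h1 := σ.le_occupation_of_subsolution hW hG π s₀ hh hH hp hle hT.le
  have h2 : 0 ≤ G * T + h s₀ := add_nonneg (by positivity) (hh s₀)
  have hH0 : 0 ≤ H := (hh 0).trans (hH 0)
  have h3 : ((G * T + h s₀ - H - W * T : ℝ) : EReal) ≤ σ.expectedCost W π s₀ T := by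
    rw [σ.expectedCost_eq hW π s₀ hT.le, EReal.coe_sub]
    refine EReal.sub_le_sub ?_ le_rfl
    have h4 := EReal.coe_ennreal_le_coe_ennreal_iff.2 h1
    rw [EReal.coe_ennreal_add, EReal.coe_ennreal_ofReal, EReal.coe_ennreal_ofReal, max_eq_left h2,
      max_eq_left hH0] at h4
    rw [EReal.coe_sub]
    exact EReal.sub_le_of_le_add h4
  refine le_trans (le_of_eq ?_)
    (mul_le_mul_of_nonneg_left h3 (by exact_mod_cast (inv_pos.2 hT).le))
  rw [← EReal.coe_mul]
  congr 1
  field_simp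
  ring

end Service

/-! ### Poisson tail ratios and the solution of the active Poisson equation -/

namespace Service

/-- The offered load `λ / μ`. -/
noncomputable def load (σ : Service) : ℝ := σ.lam / σ.mu

theorem load_pos (σ : Service) : 0 < σ.load := div_pos σ.lam_pos σ.mu_pos

/-- The ratio `P(X > s) / P(X = s)` for a Poisson variable `X` whose mean is the load. -/
noncomputable def tailRatio (σ : Service) (s : ℕ) : ℝ :=
  (Real.exp σ.load - ∑ j ∈ Finset.range (s + 1), σ.load ^ j / j.factorial)
    * (s.factorial / σ.load ^ s)

theorem tailRatio_nonneg (σ : Service) (s : ℕ) : 0 ≤ σ.tailRatio s := by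
  have := σ.load_pos
  exact mul_nonneg (sub_nonneg.2 (Real.sum_le_exp_of_nonneg this.le _)) (by positivity)

theorem succ_mul_tailRatio (σ : Service) (s : ℕ) :
    (s + 1) * σ.tailRatio s = σ.load * (1 + σ.tailRatio (s + 1)) := by
  have := σ.load_pos
  rw [tailRatio, tailRatio, Finset.sum_range_succ _ (s + 1), Nat.factorial_succ]
  push_cast
  field_simp
  ring

/-- Termwise comparison of the tail with ρ^s/s! times the exponential series, since s! i! ≤ (s +
i)!. -/
theorem tailRatio_le_exp (σ : Service) (s : ℕ) : σ.tailRatio s ≤ Real.exp σ.load := by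
  have hρ := σ.load_pos
  set x := σ.load with hx
  have h1 : ∀ n, ∑ j ∈ Finset.range (s + n), x ^ j / j.factorial
      ≤ ∑ j ∈ Finset.range s, x ^ j / j.factorial + x ^ s / s.factorial * Real.exp x := by
    intro n
    rw [Finset.sum_range_add]
    refine add_le_add_right (le_trans ?_ (mul_le_mul_of_nonneg_left
      (Real.sum_le_exp_of_nonneg hρ.le n) (by positivity))) _
    rw [Finset.mul_sum]
    refine Finset.sum_le_sum fun i _ => ?_
    rw [div_mul_div_comm, ← pow_add]
    gcongr
    exact_mod_cast Nat.le_of_dvd (Nat.factorial_pos _)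
      (Nat.factorial_mul_factorial_dvd_factorial_add s i)
  have h2 : Tendsto (fun n => ∑ j ∈ Finset.range n, x ^ j / j.factorial) atTop
      (nhds (Real.exp x)) := by
    rw [Real.exp_eq_exp_ℝ]
    exact (NormedSpace.expSeries_div_hasSum_exp x).tendsto_sum_nat
  have h3 := le_of_tendsto' (h2.comp (tendsto_add_atTop_nat s)) fun n => by
    simpa [add_comm] using h1 n
  have h4 : Real.exp x - ∑ j ∈ Finset.range (s + 1), x ^ j / j.factorial
      ≤ x ^ s / s.factorial * Real.exp x := by
    rw [Finset.sum_range_succ]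
    have : 0 ≤ x ^ s / s.factorial := by positivity
    linarith
  calc σ.tailRatio s ≤ x ^ s / s.factorial * Real.exp x * (s.factorial / x ^ s) :=
        mul_le_mul_of_nonneg_right h4 (by positivity)
    _ = Real.exp x := by field_simp

/-- As r(0) = e^ρ - 1 = ρ(1 + r(1)), the claim amounts to (1 - ρ)e^ρ < 1, the strict tangent
inequality at -ρ. -/
theorem tailRatio_one_lt_tailRatio_zero (σ : Service) : σ.tailRatio 1 < σ.tailRatio 0 := by
  have hρ := σ.load_pos
  have h0 : σ.tailRatio 0 = Real.exp σ.load - 1 := by simp [tailRatio]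
  have h1 := σ.succ_mul_tailRatio 0
  have h2 : 1 - σ.load < Real.exp (-σ.load) := by
    linarith [Real.add_one_lt_exp (neg_ne_zero.2 hρ.ne')]
  have h3 : (1 - σ.load) * Real.exp σ.load < 1 := by
    have := mul_lt_mul_of_pos_right h2 (Real.exp_pos σ.load)
    rwa [← Real.exp_add, neg_add_cancel, Real.exp_zero] at this
  norm_num at h1
  by_contra hc
  push Not at hc
  have h4 := mul_le_mul_of_nonneg_left hc hρ.le
  nlinarith

/-- Increments of the relative value function with gain `1 / μ - k`. -/
noncomputable def valueSlope (σ : Service) (k : ℝ) (s : ℕ) : ℝ :=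
  (1 / σ.mu + k * σ.tailRatio s) / σ.lam

theorem lam_mul_valueSlope (σ : Service) (k : ℝ) (s : ℕ) :
    σ.lam * σ.valueSlope k s = 1 / σ.mu + k * σ.tailRatio s := by
  have := σ.lam_pos
  rw [valueSlope]
  field_simp

/-- Subtracted from `lam_mul_valueSlope` at `s + 1`, this is the active Poisson equation with gain
1/μ - k. -/
theorem mu_mul_valueSlope (σ : Service) (k : ℝ) (s : ℕ) :
    σ.mu * (s + 1) * σ.valueSlope k s = (s + 1) / σ.lam + k * (1 + σ.tailRatio (s + 1)) := by
  have h1 := σ.lam_pos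
  have h2 := σ.mu_pos
  have h : 1 + σ.tailRatio (s + 1) = σ.mu * ((s + 1) * σ.tailRatio s) / σ.lam := by
    rw [succ_mul_tailRatio, load]
    field_simp
  rw [h, valueSlope]
  field_simp

/-- The drift of a function on the states, in terms of its increments. -/
theorem drift_sum_range (σ : Service) (d : ℕ → ℝ) (s : ℕ) (a : Bool) :
    σ.totalRate s a * (σ.nextMean (fun n => ∑ j ∈ Finset.range n, d j) s a
        - ∑ j ∈ Finset.range s, d j)
      = σ.lam * d s - σ.deathRate s a * d (s - 1) := by
  have hq := (σ.totalRate_pos s a).ne'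
  rw [nextMean, mul_sub, mul_div_cancel₀ _ hq]
  simp only [totalRate, birthRate, Finset.sum_range_succ]
  rcases s with _ | m
  · simp [deathRate]
  · rw [Nat.add_sub_cancel, Finset.sum_range_succ]
    ring

/-! ### Upper and lower bounds for the gain -/

theorem averageCost_thresholdPolicy_le (σ : Service) {W k : ℝ} (hW : 0 ≤ W) (hk : 0 ≤ k) {R : ℕ}
    (hR : k * (1 + σ.tailRatio R) = W - R / σ.lam) (s₀ : ℕ) :
    σ.averageCost W (thresholdPolicy R) s₀ ≤ ((1 / σ.mu - k : ℝ) : EReal) := by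
  have hl := σ.lam_pos
  have hu := σ.mu_pos
  have hr := σ.tailRatio_nonneg
  have hkW : k ≤ W := by
    have h1 : 0 ≤ (R : ℝ) / σ.lam := by positivity
    have h2 := mul_nonneg hk (hr R)
    linarith
  have hG : 0 ≤ W + 1 / σ.mu - k := by
    have : 0 < 1 / σ.mu := by positivity
    linarith
  have hd : ∀ s, 0 ≤ σ.valueSlope k s := fun s =>
    div_nonneg (add_nonneg (by positivity) (mul_nonneg hk (hr s))) hl.le
  have h := σ.averageCost_le_of_supersolution hW hG (thresholdPolicy R) s₀
    -- Freezing the slope below R leaves the active equation intact at s > R. By `hR` the passive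
    -- residual is 0 at s = R, and below R only the holding cost decreases.
    (h := fun n => ∑ j ∈ Finset.range n, σ.valueSlope k (max j R))
    (fun s => Finset.sum_nonneg fun j _ => hd _)
    (p := fun s a => a = decide ((R : ℤ) < s)) (σ.ae_action_thresholdPolicy R s₀) ?_
  · refine h.trans_eq ?_
    congr 1
    ring
  · intro s a ha
    rw [σ.drift_sum_range fun j => σ.valueSlope k (max j R), σ.lam_mul_valueSlope]
    rcases le_or_gt s R with hs | hs
    · have : a = false := by simpa [not_lt.2 hs] using ha
      subst this
      have h1 : (s : ℝ) / σ.lam ≤ R / σ.lam := by gcongr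
      simp only [runningCost, deathRate, max_eq_right hs, Bool.false_eq_true, if_false]
      linarith
    · have : a = true := by simpa [hs] using ha
      subst this
      obtain ⟨m, rfl⟩ : ∃ m, s = m + 1 := ⟨s - 1, by omega⟩
      have h1 := σ.mu_mul_valueSlope k m
      simp only [runningCost, deathRate, if_true, Nat.add_sub_cancel,
        max_eq_left hs.le, max_eq_left (Nat.le_of_lt_succ hs)]
      push_cast
      linarith

theorem sum_range_le_of_eventually_zero {d : ℕ → ℝ} (hd : ∀ s, 0 ≤ d s) {M : ℕ}
    (hM : ∀ s, M ≤ s → d s = 0) (s : ℕ) :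
    ∑ j ∈ Finset.range s, d j ≤ ∑ j ∈ Finset.range M, d j := by
  refine (Finset.sum_le_sum_of_subset_of_nonneg
    (Finset.range_mono (le_max_left s M)) fun j _ _ => hd j).trans_eq ?_
  symm
  refine Finset.sum_subset (Finset.range_mono (le_max_right s M)) fun j _ hj => hM j ?_
  simpa using hj

/-- The relation `p` holds the pairs the policy actually visits, so the Bellman inequality is
required only there. This permits negative k when state 0 is never active. -/
theorem le_averageCost_of_action (σ : Service) {W k : ℝ} (hW : 0 ≤ W) (hkW : k ≤ W)
    (hk : ∀ s, 0 ≤ 1 / σ.mu + k * σ.tailRatio s) (π : Policy) (s₀ : ℕ) {p : ℕ → Bool → Prop}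
    (hp : ∀ n, ∀ᵐ ω ∂σ.pathLaw π s₀, p (ω n).1.2 (ω n).2)
    (hactive : p 0 true → 0 ≤ k)
    (hpassive : ∀ s, p s false → W - s / σ.lam ≤ k * (1 + σ.tailRatio s)) :
    ((1 / σ.mu - k : ℝ) : EReal) ≤ σ.averageCost W π s₀ := by
  have hl := σ.lam_pos
  have hu := σ.mu_pos
  have hρ := σ.load_pos
  have hlim : Tendsto (fun δ : ℝ => ((1 / σ.mu - k - δ : ℝ) : EReal)) (nhdsWithin 0 (Set.Ioi 0))
      (nhds ((1 / σ.mu - k : ℝ) : EReal)) := by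
    refine (continuous_coe_real_ereal.tendsto _).comp (tendsto_nhdsWithin_of_tendsto_nhds ?_)
    have : Continuous fun δ : ℝ => 1 / σ.mu - k - δ := by fun_prop
    simpa using this.tendsto 0
  refine le_of_tendsto hlim ?_
  filter_upwards [Ioo_mem_nhdsGT (show (0 : ℝ) < 1 / σ.mu by positivity)] with δ hδ
  have hδ0 : 0 < δ := hδ.1
  have hG : 0 ≤ W + 1 / σ.mu - k - δ := by linarith [hδ.2]
  -- From N on, the holding cost alone exceeds the shifted gain, so errors in the slopes matter only
  -- below N.
  obtain ⟨N, hN⟩ := exists_nat_ge (σ.lam * (W + 1 / σ.mu - k))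
  have hlarge : ∀ s : ℕ, N ≤ s → W + 1 / σ.mu - k ≤ s / σ.lam := by
    intro s hs
    rw [le_div_iff₀ hl, mul_comm]
    exact hN.trans (by exact_mod_cast hs)
  -- A solution of the homogeneous active equation (`hesucc`): subtracting a multiple of it changes
  -- no active residual at s ≥ 1. It grows factorially, while `valueSlope` stays bounded.
  set e : ℕ → ℝ := fun s => s.factorial / σ.load ^ s
  have he : ∀ s, 0 < e s := fun s => by positivity
  have hesucc : ∀ s, σ.mu * (s + 1) * e s = σ.lam * e (s + 1) := by
    intro s
    have hload : σ.mu * σ.load = σ.lam := mul_div_cancel₀ _ hu.ne'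
    simp only [e, Nat.factorial_succ, ← hload, pow_succ]
    push_cast
    field_simp
  set E := ∑ s ∈ Finset.range N, e s
  have hE : 0 ≤ E := Finset.sum_nonneg fun s _ => (he s).le
  -- Small enough that the correction costs at most the slack δ in every state below N.
  set ε := δ / (σ.lam * (E + 1))
  have hε : 0 < ε := by positivity
  have hεe : ∀ s, s < N → σ.lam * (ε * e s) ≤ δ := by
    intro s hs
    have h1 : e s ≤ E + 1 := (Finset.single_le_sum (fun i _ => (he i).le)
      (Finset.mem_range.2 hs)).trans (by linarith)
    calc σ.lam * (ε * e s) ≤ σ.lam * (ε * (E + 1)) := by gcongr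
      _ = δ := by simp only [ε]; field_simp
  -- These slopes vanish eventually, so their partial sums are bounded, as the lower verification
  -- requires.
  set d : ℕ → ℝ := fun s => max (σ.valueSlope k s - ε * e s) 0
  have hd : ∀ s, 0 ≤ d s := fun s => le_max_right _ _
  have hdle : ∀ s, σ.valueSlope k s - ε * e s ≤ d s := fun s => le_max_left _ _
  have hldle : ∀ s, 1 / σ.mu + k * σ.tailRatio s - σ.lam * (ε * e s) ≤ σ.lam * d s := by
    intro s
    rw [← lam_mul_valueSlope, ← mul_sub]
    exact mul_le_mul_of_nonneg_left (hdle s) hl.le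
  have hld : ∀ s, 0 ≤ σ.lam * d s := fun s => mul_nonneg hl.le (hd s)
  obtain ⟨M, hM⟩ : ∃ M, ∀ s, M ≤ s → d s = 0 := by
    set D := (1 / σ.mu + |k| * Real.exp σ.load) / σ.lam
    have hD : 0 < D := by positivity
    have hDle : ∀ s, σ.valueSlope k s ≤ D := by
      intro s
      refine div_le_div_of_nonneg_right (add_le_add_right ?_ _) hl.le
      exact mul_le_mul (le_abs_self k) (σ.tailRatio_le_exp s) (σ.tailRatio_nonneg s) (abs_nonneg k)
    obtain ⟨M, hM⟩ := eventually_atTop.1 ((FloorSemiring.tendsto_pow_div_factorial_atTop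
      σ.load).eventually_lt_const (show 0 < ε / D by positivity))
    refine ⟨M, fun s hs => max_eq_right (sub_nonpos.2 ((hDle s).trans ?_))⟩
    have h1 := hM s hs
    rw [div_lt_div_iff₀ (by positivity) hD] at h1
    simp only [e]
    rw [← mul_div_assoc, le_div_iff₀ (by positivity)]
    linarith
  have h := σ.le_averageCost_of_subsolution hW hG π s₀ (h := fun n => ∑ j ∈ Finset.range n, d j)
    (fun s => Finset.sum_nonneg fun j _ => hd j) (sum_range_le_of_eventually_zero hd hM) hp ?_
  · refine le_trans (le_of_eq ?_) h
    congr 1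
    ring
  · intro s a hpa
    rw [σ.drift_sum_range d]
    cases a with
    | false =>
      simp only [runningCost, deathRate, Bool.false_eq_true, if_false]
      rcases le_or_gt N s with hs | hs
      · linarith [hlarge s hs, hld s]
      · linarith [hldle s, hεe s hs, hpassive s hpa]
    | true =>
      rcases s with _ | m
      · simp only [runningCost, deathRate, if_true, Nat.cast_zero, mul_zero, zero_mul, zero_div]
        rcases le_or_gt N 0 with hs | hs
        · have := hlarge 0 hs
          rw [Nat.cast_zero, zero_div] at this
          linarith [hld 0]
        · have h1 := mul_nonneg (hactive hpa) (σ.tailRatio_nonneg 0)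
          linarith [hldle 0, hεe 0 hs, hactive hpa]
      · have hact := σ.mu_mul_valueSlope k m
        simp only [runningCost, deathRate, if_true, Nat.add_sub_cancel]
        rcases le_total (σ.valueSlope k m - ε * e m) 0 with hm | hm
        · have hdm : d m = 0 := max_eq_right hm
          rw [hdm, mul_zero]
          rcases le_or_gt N (m + 1) with hs | hs
          · linarith [hld (m + 1), hlarge (m + 1) hs]
          · have h1 : 0 ≤ σ.mu * (m + 1) * σ.valueSlope k m :=
              mul_nonneg (by positivity) (div_nonneg (hk m) hl.le)
            have h2 := hldle (m + 1)
            have h3 := hεe (m + 1) hs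
            push_cast
            linarith
        · have hdm : d m = σ.valueSlope k m - ε * e m := max_eq_left hm
          have h1 : σ.mu * (m + 1) * d m = (m + 1) / σ.lam + k * (1 + σ.tailRatio (m + 1))
              - σ.lam * (ε * e (m + 1)) := by
            rw [hdm, mul_sub, hact, mul_left_comm σ.lam, ← hesucc]
            ring
          have h2 := hldle (m + 1)
          push_cast
          linarith

/-! ### Choice of the threshold and its dependence on the subsidy -/

/-- The reduction `1 / μ - g` of the gain `g` achieved by the threshold `R` with subsidy `W`. -/
noncomputable def thresholdSaving (σ : Service) (W : ℝ) (R : ℕ) : ℝ :=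
  (W - R / σ.lam) / (1 + σ.tailRatio R)

theorem thresholdSaving_mul (σ : Service) (W : ℝ) (R : ℕ) :
    σ.thresholdSaving W R * (1 + σ.tailRatio R) = W - R / σ.lam := by
  have := σ.tailRatio_nonneg R
  exact div_mul_cancel₀ _ (by positivity)

theorem thresholdSaving_zero_nonneg (σ : Service) {W : ℝ} (hW : 0 ≤ W) :
    0 ≤ σ.thresholdSaving W 0 := by
  have := σ.tailRatio_nonneg 0
  rw [thresholdSaving, Nat.cast_zero, zero_div, sub_zero]
  positivity

theorem thresholdSaving_le (σ : Service) {W : ℝ} (hW : 0 ≤ W) (R : ℕ) :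
    σ.thresholdSaving W R ≤ W := by
  have h1 := σ.tailRatio_nonneg R
  have h2 := σ.lam_pos
  have h3 : 0 ≤ (R : ℝ) / σ.lam := by positivity
  rw [thresholdSaving, div_le_iff₀ (by positivity)]
  nlinarith

/-- Savings are nonpositive for s ≥ λW, whereas the saving at 0 is nonnegative, so a finite maximum
suffices. -/
theorem exists_thresholdSaving_max (σ : Service) {W : ℝ} (hW : 0 ≤ W) :
    ∃ R, ∀ s, σ.thresholdSaving W s ≤ σ.thresholdSaving W R := by
  have hl := σ.lam_pos
  obtain ⟨N, hN⟩ := exists_nat_ge (σ.lam * W)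
  obtain ⟨R, -, hR⟩ := Finset.exists_max_image (Finset.range (N + 1)) (σ.thresholdSaving W)
    ⟨0, by simp⟩
  refine ⟨R, fun s => ?_⟩
  rcases lt_or_ge s (N + 1) with hs | hs
  · exact hR s (Finset.mem_range.2 hs)
  · refine le_trans ?_ ((σ.thresholdSaving_zero_nonneg hW).trans (hR 0 (by simp)))
    refine div_nonpos_of_nonpos_of_nonneg ?_ (by linarith [σ.tailRatio_nonneg s])
    rw [sub_nonpos, le_div_iff₀ hl, mul_comm]
    exact hN.trans (by exact_mod_cast (Nat.le_succ N).trans hs)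

theorem exists_isOptimal_thresholdPolicy (σ : Service) {W : ℝ} (hW : 0 ≤ W) :
    ∃ R : ℕ, σ.IsOptimal W (thresholdPolicy R) := by
  obtain ⟨R, hR⟩ := σ.exists_thresholdSaving_max hW
  have hk := (σ.thresholdSaving_zero_nonneg hW).trans (hR 0)
  have hu := σ.mu_pos
  have hr := σ.tailRatio_nonneg
  refine ⟨R, fun s₀ π' =>
    (σ.averageCost_thresholdPolicy_le hW hk (σ.thresholdSaving_mul W R) s₀).trans ?_⟩
  refine σ.le_averageCost_of_action hW (σ.thresholdSaving_le hW R)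
    (fun s => add_nonneg (by positivity) (mul_nonneg hk (hr s))) π' s₀ (p := fun _ _ => True)
    (fun _ => by simp) (fun _ => hk) fun s _ => ?_
  rw [← thresholdSaving_mul]
  exact mul_le_mul_of_nonneg_right (hR s) (by linarith [hr s])

/-- Started in R, the policy never goes below R ≥ 1 and gets nothing for its passivity there, so its
gain exceeds 1/μ, which the threshold 0 attains. -/
theorem not_isOptimal_zero_thresholdPolicy (σ : Service) {R : ℕ} (hR : R ≠ 0) :
    ¬ σ.IsOptimal 0 (thresholdPolicy R) := by
  intro hopt
  have hl := σ.lam_pos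
  have hu := σ.mu_pos
  have hr := σ.tailRatio_nonneg
  have hR0 : (0 : ℝ) < R := by exact_mod_cast Nat.pos_of_ne_zero hR
  have hrR : 0 < 1 + σ.tailRatio R := by linarith [hr R]
  -- The lower bound is used with k = -κ: the first bound on κ keeps all slopes nonnegative, the
  -- second is the passive condition at R, the only passive state visited.
  obtain ⟨κ, hκ, hκ1, hκ2⟩ : ∃ κ : ℝ, 0 < κ ∧ κ * Real.exp σ.load ≤ 1 / σ.mu
      ∧ κ * (1 + σ.tailRatio R) ≤ R / σ.lam := by
    refine ⟨min (1 / σ.mu / Real.exp σ.load) (R / σ.lam / (1 + σ.tailRatio R)), ?_, ?_, ?_⟩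
    · exact lt_min (by positivity) (by positivity)
    · rw [← le_div_iff₀ (Real.exp_pos _)]
      exact min_le_left _ _
    · rw [← le_div_iff₀ hrR]
      exact min_le_right _ _
  have hact := σ.ae_action_thresholdPolicy R R
  have h1 := σ.averageCost_thresholdPolicy_le (W := 0) (k := 0) le_rfl le_rfl (R := 0) (by simp) R
  have h2 := σ.le_averageCost_of_action (W := 0) (k := -κ) le_rfl (by linarith)
    (fun s => by
      have := mul_le_mul_of_nonneg_left (σ.tailRatio_le_exp s) hκ.le
      linarith)
    (thresholdPolicy R) R (p := fun s a => R ≤ s ∧ a = decide ((R : ℤ) < s))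
    (fun n => (σ.ae_state_induction (thresholdPolicy R) R (p := fun _ s => R ≤ s)
      (q := fun s a => a = decide ((R : ℤ) < s)) le_rfl hact
      (fun _ s _ h _ => h.trans (Nat.le_succ s))
      (fun _ s _ _ h => by
        have : R < s := by simpa using h.symm
        omega) n).and (hact n))
    (fun h => absurd (Nat.le_zero.1 h.1) hR)
    (fun s h => by
      have h3 : s ≤ R := by simpa using h.2.symm
      obtain rfl : s = R := le_antisymm h3 h.1
      linarith)
  have h3 := EReal.coe_le_coe_iff.1 (h2.trans ((hopt R _).trans h1))
  linarith

theorem exists_not_isOptimal_thresholdPolicy (σ : Service) :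
    ∃ W : ℝ, 0 ≤ W ∧ ∀ R : ℤ, R ≤ 0 → ¬ σ.IsOptimal W (thresholdPolicy R) := by
  have hl := σ.lam_pos
  have hu := σ.mu_pos
  have hr := σ.tailRatio_nonneg
  have hlt := sub_pos.2 σ.tailRatio_one_lt_tailRatio_zero
  have h0 : 0 < 1 + σ.tailRatio 0 := by linarith [hr 0]
  have h1 : 0 < 1 + σ.tailRatio 1 := by linarith [hr 1]
  -- The threshold 1 saves more than the threshold 0 exactly when W exceeds the first summand.
  set W := (1 + σ.tailRatio 0) / σ.lam / (σ.tailRatio 0 - σ.tailRatio 1) + 1 with hWdef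
  have hW : 0 ≤ W := by positivity
  have hk0 := σ.thresholdSaving_zero_nonneg hW
  have hsav : σ.thresholdSaving W 0 < σ.thresholdSaving W 1 := by
    rw [thresholdSaving, thresholdSaving, div_lt_div_iff₀ h0 h1]
    have h2 : W * (σ.tailRatio 0 - σ.tailRatio 1)
        = (1 + σ.tailRatio 0) / σ.lam + (σ.tailRatio 0 - σ.tailRatio 1) := by
      rw [hWdef, add_mul, div_mul_cancel₀ _ hlt.ne', one_mul]
    have h3 : (1 : ℝ) / σ.lam * (1 + σ.tailRatio 0) = (1 + σ.tailRatio 0) / σ.lam := by ring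
    push_cast
    rw [zero_div, sub_zero, sub_mul, h3]
    linarith
  refine ⟨W, hW, fun R hR hopt => ?_⟩
  have h2 := σ.averageCost_thresholdPolicy_le hW (hk0.trans hsav.le)
    (σ.thresholdSaving_mul W 1) 0
  have h3 := σ.le_averageCost_of_action hW (σ.thresholdSaving_le hW 0)
    (fun s => add_nonneg (by positivity) (mul_nonneg hk0 (hr s))) (thresholdPolicy R) 0
    -- For R ≤ 0 passivity can occur only in state 0, so the passive condition is needed only there
    -- and k may be the saving of the threshold 0, even for always-active policies.
    (p := fun s a => a = true ∨ s = 0)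
    (fun n => by
      filter_upwards [σ.ae_action_thresholdPolicy R 0 n] with ω hω
      rw [hω, decide_eq_true_iff]
      omega)
    (fun _ => hk0)
    (fun s h => by
      obtain rfl : s = 0 := by simpa using h
      exact (σ.thresholdSaving_mul W 0).ge)
  have h4 := EReal.coe_le_coe_iff.1 (h3.trans ((hopt 0 _).trans h2))
  linarith

end Service

theorem mainTheorem4 (σ : Service) :
    (∀ W : ℝ, 0 ≤ W → ∃ R : ℕ, σ.IsOptimal W (thresholdPolicy R)) ∧
      ¬ ∃ R : ℤ, ∀ W : ℝ, 0 ≤ W → σ.IsOptimal W (thresholdPolicy R) := by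
  refine ⟨fun W hW => σ.exists_isOptimal_thresholdPolicy hW, ?_⟩
  rintro ⟨R, hR⟩
  rcases le_or_gt R 0 with h | h
  · obtain ⟨W, hW, hno⟩ := σ.exists_not_isOptimal_thresholdPolicy
    exact hno R h (hR W hW)
  · lift R to ℕ using h.le
    exact σ.not_isOptimal_zero_thresholdPolicy (by exact_mod_cast h.ne') (hR 0 le_rfl)
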